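/- Let $w$ be a strictly positive analytic weight on the unit circle $\mathbb T_1=\{|z|=1\}$, let $\Phi_n$ ($n\ge 0$) be the monic polynomials of degree $n$ orthogonal with respect to the measure $w(z)\,|dz|$ on $\mathbb T_1$, let $\alpha_n=-\overline{\Phi_{n+1}(0)}$ be the Verblunsky coefficients, and let $G(z)=\sum_{n=0}^\infty \alpha_n z^n$. Let $$D(w;z)=\exp\left(\frac1{4\pi}\int_0^{2\pi}\log w(e^{i\theta})\,\frac{e^{i\theta}+z}{e^{i\theta}-z}\,d\theta\right),\qquad |z|\ne 1,$$ be the Szegő function, let $D_{\rm i}(w;\cdot)$ and $D_{\rm e}(w;\cdot)$ be its restrictions to $|z|<1$ and $|z|>1$, continued holomorphically across $\mathbb T_1$, and let $\mathcal S(w;z)=D_{\rm i}(w;z)\,D_{\rm e}(w;z)$ be the scattering function. Let $$\rho=\inf\{0<r<1:\ D_{\rm e}(w;z)\text{ is (continues to) a holomorphic function in } |z|>r\}.$$ Then $\rho=\limsup_{n\to\infty}|\alpha_n|^{1/n}<1$; in a neighborhood of $\mathbb T_1$ the series $G$ converges and $\mathcal S(w;\cdot)$ is holomorphic and non-vanishing;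 and the function $$G(z)+\frac{1}{z\,\mathcal S(w;z)},$$ defined in a neighborhood of $\mathbb T_1$, can be continued as a holomorphic function to the annulus $1<|z|<1/\rho^3$ (with $1/\rho^3=\infty$ if $\rho=0$). More precisely, for some $0<\varepsilon<1$ there is a function holomorphic in $1-\varepsilon<|z|<1/\rho^3$ that is equal to $G(z)+1/(z\,\mathcal S(w;z))$ for $1-\varepsilon<|z|<1+\varepsilon$. -/

import Mathlib

open Filter Topology Polynomial

namespace OPUC

noncomputable section

/-- A weight on the unit circle is analytic: it is the restriction to the circle of a function
holomorphic in a neighbourhood of the circle. -/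
def IsAnalyticWeight (w : Circle → ℝ) : Prop :=
  ∃ W : ℂ → ℂ, AnalyticOnNhd ℂ W (Metric.sphere 0 1) ∧ ∀ t : Circle, W t = (w t : ℂ)

/-- The pairing `∮ p(z) conj(q(z)) w(z) |dz|` over the unit circle. -/
def pairing (w : Circle → ℝ) (p q : ℂ[X]) : ℂ :=
  ∫ θ in (0 : ℝ)..2 * Real.pi,
    p.eval (Circle.exp θ : ℂ) * (starRingEnd ℂ) (q.eval (Circle.exp θ : ℂ)) *
      (w (Circle.exp θ) : ℂ)

/-- The monic orthogonal polynomials `Φ_n` of the measure `w(z) |dz|`, by Gram-Schmidt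
orthogonalization of `1, z, z², …`. -/
def monicOP (w : Circle → ℝ) (n : ℕ) : ℂ[X] :=
  X ^ n - ∑ k : Fin n,
    C (pairing w (X ^ n) (monicOP w k) / pairing w (monicOP w k) (monicOP w k)) * monicOP w k
termination_by n
decreasing_by all_goals exact k.2

/-- The Verblunsky coefficients `α_n = - conj (Φ_{n+1}(0))`. -/
def verblunsky (w : Circle → ℝ) (n : ℕ) : ℂ :=
  -(starRingEnd ℂ) ((monicOP w (n + 1)).eval 0)

/-- The Szegő function, given by its integral formula for `|z| ≠ 1`. -/
def szego (w : Circle → ℝ) (z : ℂ) : ℂ :=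
  Complex.exp ((1 / (4 * Real.pi) : ℂ) * ∫ θ in (0 : ℝ)..2 * Real.pi,
    (Real.log (w (Circle.exp θ)) : ℂ) *
      (((Circle.exp θ : ℂ) + z) / ((Circle.exp θ : ℂ) - z)))

/-- `F` is a holomorphic continuation to `|z| > r` of the exterior Szegő function
(the restriction of `szego w` to `|z| > 1`). -/
def IsExteriorContinuation (w : Circle → ℝ) (r : ℝ) (F : ℂ → ℂ) : Prop :=
  DifferentiableOn ℂ F {z | r < ‖z‖} ∧ ∀ z : ℂ, 1 < ‖z‖ → F z = szego w z

/-- `F` is a holomorphic continuation to `|z| < R` of the interior Szegő function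
(the restriction of `szego w` to `|z| < 1`). -/
def IsInteriorContinuation (w : Circle → ℝ) (R : ℝ) (F : ℂ → ℂ) : Prop :=
  DifferentiableOn ℂ F {z | ‖z‖ < R} ∧ ∀ z : ℂ, ‖z‖ < 1 → F z = szego w z

open Classical in
/-- `D_e(w; z)`: the value at `z` of the holomorphic continuation of the exterior Szegő function
to a domain `|ζ| > r` with `0 < r ≤ 1` that contains `z`; by the identity theorem it does not
depend on the continuation chosen. (The value is `0` where there is no such continuation.) -/
def szegoExt (w : Circle → ℝ) (z : ℂ) : ℂ :=
  if h : ∃ F : ℂ → ℂ, ∃ r : ℝ, 0 < r ∧ r ≤ 1 ∧ r < ‖z‖ ∧ IsExteriorContinuation w r F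
  then h.choose z else 0

open Classical in
/-- `D_i(w; z)`: the value at `z` of the holomorphic continuation of the interior Szegő function
to a disc `|ζ| < R` with `1 ≤ R` that contains `z`; by the identity theorem it does not
depend on the continuation chosen. (The value is `0` where there is no such continuation.) -/
def szegoInt (w : Circle → ℝ) (z : ℂ) : ℂ :=
  if h : ∃ F : ℂ → ℂ, ∃ R : ℝ, 1 ≤ R ∧ ‖z‖ < R ∧ IsInteriorContinuation w R F
  then h.choose z else 0

/-- The scattering function `𝒮(w; z) = D_i(w; z) D_e(w; z)`. -/
def scattering (w : Circle → ℝ) (z : ℂ) : ℂ := szegoInt w z * szegoExt w z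

/-- `ρ = inf {0 < r < 1 : D_e(w; ·) is holomorphic in |z| > r}`. -/
def criticalRadius (w : Circle → ℝ) : ℝ :=
  sInf {r : ℝ | 0 < r ∧ r < 1 ∧ ∃ F : ℂ → ℂ, IsExteriorContinuation w r F}

/-! The polynomials `Φ_n` are monic of degree `n` and pairwise orthogonal. -/

theorem monicOP_eq (w : Circle → ℝ) (n : ℕ) :
    monicOP w n = X ^ n - ∑ k : Fin n,
      C (pairing w (X ^ n) (monicOP w k) / pairing w (monicOP w k) (monicOP w k)) *
        monicOP w k := by
  rw [monicOP]

theorem monicOP_monic_natDegree (w : Circle → ℝ) (n : ℕ) :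
    (monicOP w n).Monic ∧ (monicOP w n).natDegree = n := by
  induction n using Nat.strong_induction_on with
  | _ n ih =>
    have hlt : (∑ k : Fin n,
        C (pairing w (X ^ n) (monicOP w k) / pairing w (monicOP w k) (monicOP w k)) *
          monicOP w k).degree < ((X : ℂ[X]) ^ n).degree := by
      rw [degree_X_pow]
      refine (degree_sum_le _ _).trans_lt ?_
      rw [Finset.sup_lt_iff (by exact WithBot.bot_lt_coe n)]
      intro k _
      refine lt_of_le_of_lt (b := (monicOP w k).degree) ?_ ?_
      · rw [← smul_eq_C_mul]
        exact degree_smul_le _ _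
      rw [degree_eq_natDegree (ih k k.2).1.ne_zero, (ih k k.2).2]
      exact_mod_cast k.2
    have hdeg : (monicOP w n).degree = n := by
      rw [monicOP_eq, degree_sub_eq_left_of_degree_lt hlt, degree_X_pow]
    refine ⟨?_, natDegree_eq_of_degree_eq_some hdeg⟩
    rw [monicOP_eq]
    exact (monic_X_pow n).sub_of_left hlt

theorem continuous_pairing_integrand {w : Circle → ℝ} (hw : Continuous w) (p q : ℂ[X]) :
    Continuous fun θ : ℝ => p.eval (Circle.exp θ : ℂ) *
      (starRingEnd ℂ) (q.eval (Circle.exp θ : ℂ)) * (w (Circle.exp θ) : ℂ) := by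
  have he : Continuous fun θ : ℝ => (Circle.exp θ : ℂ) :=
    continuous_subtype_val.comp Circle.exp.continuous
  refine ((p.continuous.comp he).mul (Complex.continuous_conj.comp (q.continuous.comp he))).mul ?_
  exact Complex.continuous_ofReal.comp (hw.comp Circle.exp.continuous)

theorem pairing_sub_left {w : Circle → ℝ} (hw : Continuous w) (p q s : ℂ[X]) :
    pairing w (p - q) s = pairing w p s - pairing w q s := by
  unfold pairing
  rw [← intervalIntegral.integral_sub
    ((continuous_pairing_integrand hw p s).intervalIntegrable _ _)
    ((continuous_pairing_integrand hw q s).intervalIntegrable _ _)]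
  simp only [eval_sub, sub_mul]

theorem pairing_C_mul_left (w : Circle → ℝ) (c : ℂ) (p s : ℂ[X]) :
    pairing w (C c * p) s = c * pairing w p s := by
  unfold pairing
  rw [← intervalIntegral.integral_const_mul]
  simp only [eval_mul, eval_C, mul_assoc]

theorem pairing_sum_left {w : Circle → ℝ} (hw : Continuous w) {ι : Type*} (t : Finset ι)
    (p : ι → ℂ[X]) (s : ℂ[X]) :
    pairing w (∑ i ∈ t, p i) s = ∑ i ∈ t, pairing w (p i) s := by
  unfold pairing
  rw [← intervalIntegral.integral_finsetSum
    fun i _ => (continuous_pairing_integrand hw (p i) s).intervalIntegrable _ _]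
  simp only [eval_finsetSum, Finset.sum_mul]

theorem pairing_conj (w : Circle → ℝ) (p q : ℂ[X]) :
    (starRingEnd ℂ) (pairing w p q) = pairing w q p := by
  unfold pairing
  rw [intervalIntegral.integral_of_le Real.two_pi_pos.le,
    intervalIntegral.integral_of_le Real.two_pi_pos.le, ← integral_conj]
  simp [mul_comm]

theorem pairing_self_ne_zero {w : Circle → ℝ} (hw : Continuous w) (hpos : ∀ t, 0 < w t)
    {p : ℂ[X]} (hp : p ≠ 0) : pairing w p p ≠ 0 := by
  have hre : pairing w p p = ((∫ θ in (0 : ℝ)..2 * Real.pi,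
      Complex.normSq (p.eval (Circle.exp θ : ℂ)) * w (Circle.exp θ) : ℝ) : ℂ) := by
    unfold pairing
    rw [← intervalIntegral.integral_ofReal]
    simp only [Complex.mul_conj, Complex.ofReal_mul]
  have he : Continuous fun θ : ℝ => (Circle.exp θ : ℂ) :=
    continuous_subtype_val.comp Circle.exp.continuous
  have hex : ∃ c ∈ Set.Icc (0 : ℝ) (2 * Real.pi), p.eval (Circle.exp c : ℂ) ≠ 0 := by
    by_contra! h
    refine hp (eq_zero_of_infinite_isRoot p ?_)
    have hinj : Set.InjOn (fun θ : ℝ => (Circle.exp θ : ℂ)) (Set.Ioc (-Real.pi) Real.pi) := by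
      intro a ha b hb hab
      have h2 : Complex.arg (Circle.exp a) = Complex.arg (Circle.exp b) := congrArg _ hab
      rwa [Circle.arg_exp ha.1 ha.2, Circle.arg_exp hb.1 hb.2] at h2
    have hsub : Set.Ioo (0 : ℝ) Real.pi ⊆ Set.Ioc (-Real.pi) Real.pi := fun x hx =>
      ⟨by linarith [hx.1, Real.pi_pos], hx.2.le⟩
    refine ((Set.Ioo_infinite Real.pi_pos).image (hinj.mono hsub)).mono ?_
    rintro _ ⟨θ, hθ, rfl⟩
    exact h θ ⟨hθ.1.le, by linarith [hθ.2, Real.pi_pos]⟩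
  obtain ⟨c, hc, hpc⟩ := hex
  rw [hre, Complex.ofReal_ne_zero]
  refine (intervalIntegral.integral_pos Real.two_pi_pos ?_ ?_ ⟨c, hc, ?_⟩).ne'
  · exact ((Complex.continuous_normSq.comp (p.continuous.comp he)).mul
      (hw.comp Circle.exp.continuous)).continuousOn
  · exact fun θ _ => mul_nonneg (Complex.normSq_nonneg _) (hpos _).le
  · exact mul_pos (Complex.normSq_pos.2 hpc) (hpos _)

theorem pairing_monicOP {w : Circle → ℝ} (hw : Continuous w) (hpos : ∀ t, 0 < w t) {m n : ℕ}
    (hmn : m ≠ n) : pairing w (monicOP w n) (monicOP w m) = 0 := by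
  have key : ∀ n : ℕ, ∀ m < n, pairing w (monicOP w n) (monicOP w m) = 0 := by
    intro n
    induction n using Nat.strong_induction_on with
    | _ n ih =>
      intro m hm
      have hne := pairing_self_ne_zero hw hpos (monicOP_monic_natDegree w m).1.ne_zero
      rw [monicOP_eq w n, pairing_sub_left hw, pairing_sum_left hw,
        Finset.sum_eq_single (⟨m, hm⟩ : Fin n)]
      · rw [pairing_C_mul_left, div_mul_cancel₀ _ hne, sub_self]
      · intro k _ hk
        rw [pairing_C_mul_left]
        have hkm : (k : ℕ) ≠ m := fun h => hk (Fin.ext h)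
        rcases lt_or_gt_of_ne hkm with h | h
        · rw [← pairing_conj w (monicOP w m), ih m hm k h, map_zero, mul_zero]
        · rw [ih k k.2 m h, mul_zero]
      · exact fun h => absurd (Finset.mem_univ _) h
  rcases lt_or_gt_of_ne hmn with h | h
  · exact key n m h
  · rw [← pairing_conj w (monicOP w m), key m n h, map_zero]

end

end OPUC

/-! Let D be the interior Szegő function, continued across the circle, and D*(z) = conj D(1/conj z)
(`refl D`). Then w = D D* on the circle, D_e = 1/D*, and 1/𝒮 = B with B = D*/D = ∑ b_k z^k near the
circle.

Orthogonality says that Φ_n w has no Fourier coefficient of index 0 ≤ k < n, so Φ_n w = z^n P + N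
with P holomorphic in the disc and N of purely negative frequencies. Dividing by D* and by D gives D
Φ_n = z^n B* (P/D) + N/D* and D* Φ_n = z^n (P/D) + B (N/D*). Comparing coefficients yields a Hankel
system for the coefficients of P/D and N/D* whose entries are b_k, or their conjugates, with k ≥ n
(`exists_hankel_system`). If b_k = O(r^k), eliminating N/D* costs two factors r^n, so P/D = D(0) +
O(r^{2n}), and one more factor gives Φ_n(0) = conj b_n + O(r^{3n}) (`norm_sub_le_of_hankel_system`).
Hence α_n + b_{n+1} = O(r^{3n}).

Since D_e = (1/D)*, the radius ρ is governed by the decay of the Taylor coefficients of 1/D.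
Multiplication by D* or 1/D* involves only nonpositive powers of z, so 1/D and B = D*·(1/D) share
their decay rates at positive indices, and every r in (ρ, 1) is admissible above. The limsup formula
follows because ρ³ < ρ when ρ > 0. Finally G + B/z = ∑ (α_n + b_{n+1}) z^n + z⁻¹ ∑_{m ≥ 0} b_{-m}
z^{-m}: the first series converges for |z| < ρ⁻³, the second outside a disc of radius less than 1.
-/

namespace OPUC

noncomputable section

/-! ### Fourier coefficients on the unit circle -/

/-- The `k`-th Fourier coefficient of the restriction of `f` to the unit circle. -/
def lcoef (f : ℂ → ℂ) (k : ℤ) : ℂ :=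
  (2 * Real.pi : ℂ)⁻¹ * ∫ θ in (0 : ℝ)..2 * Real.pi,
    (Circle.exp θ : ℂ) ^ (-k) * f (Circle.exp θ)

/-- The open annulus `r < |z| < R`. -/
def annulus (r R : ℝ) : Set ℂ := {z | r < ‖z‖ ∧ ‖z‖ < R}

theorem isOpen_annulus (r R : ℝ) : IsOpen (annulus r R) :=
  (isOpen_lt continuous_const continuous_norm).inter (isOpen_lt continuous_norm continuous_const)

theorem sphere_subset_annulus {r R : ℝ} (hr : r < 1) (hR : 1 < R) :
    Metric.sphere (0 : ℂ) 1 ⊆ annulus r R := by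
  intro z hz
  rw [mem_sphere_zero_iff_norm] at hz
  exact ⟨by rw [hz]; exact hr, by rw [hz]; exact hR⟩

theorem exp_mem_sphere (θ : ℝ) : (Circle.exp θ : ℂ) ∈ Metric.sphere (0 : ℂ) 1 := by
  simp

theorem coe_mem_sphere (t : Circle) : (t : ℂ) ∈ Metric.sphere (0 : ℂ) 1 := by
  rw [mem_sphere_zero_iff_norm]
  exact t.norm_coe

theorem continuous_comp_exp {f : ℂ → ℂ} (hf : ContinuousOn f (Metric.sphere 0 1)) :
    Continuous fun θ : ℝ => f (Circle.exp θ) :=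
  hf.comp_continuous (continuous_subtype_val.comp Circle.exp.continuous) exp_mem_sphere

theorem continuousOn_zpow_sphere (k : ℤ) :
    ContinuousOn (fun z : ℂ => z ^ k) (Metric.sphere 0 1) := fun z hz =>
  (continuousAt_zpow₀ z k (Or.inl (ne_zero_of_mem_unit_sphere ⟨z, hz⟩))).continuousWithinAt

theorem continuous_exp_zpow (k : ℤ) : Continuous fun θ : ℝ => (Circle.exp θ : ℂ) ^ k :=
  continuous_comp_exp (continuousOn_zpow_sphere k)

theorem continuous_exp_zpow_mul {f : ℂ → ℂ} (hf : ContinuousOn f (Metric.sphere 0 1)) (k : ℤ) :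
    Continuous fun θ : ℝ => (Circle.exp θ : ℂ) ^ k * f (Circle.exp θ) :=
  (continuous_exp_zpow k).mul (continuous_comp_exp hf)

theorem lcoef_congr {f g : ℂ → ℂ} (h : ∀ t : Circle, f t = g t) (k : ℤ) :
    lcoef f k = lcoef g k := by
  simp only [lcoef, h]

theorem lcoef_sub {f g : ℂ → ℂ} (hf : ContinuousOn f (Metric.sphere 0 1))
    (hg : ContinuousOn g (Metric.sphere 0 1)) (k : ℤ) :
    lcoef (fun z => f z - g z) k = lcoef f k - lcoef g k := by
  simp only [lcoef]
  rw [← mul_sub, ← intervalIntegral.integral_sub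
    ((continuous_exp_zpow_mul hf _).intervalIntegrable _ _)
    ((continuous_exp_zpow_mul hg _).intervalIntegrable _ _)]
  simp only [mul_sub]

theorem lcoef_zpow_mul (f : ℂ → ℂ) (m k : ℤ) :
    lcoef (fun z => z ^ m * f z) k = lcoef f (k - m) := by
  simp only [lcoef]
  congr 2
  funext θ
  rw [← mul_assoc, ← zpow_add₀ (Circle.coe_ne_zero _)]
  congr 2
  ring

theorem norm_lcoef_le {f : ℂ → ℂ} {M : ℝ} (hM : ∀ z ∈ Metric.sphere (0 : ℂ) 1, ‖f z‖ ≤ M)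
    (k : ℤ) : ‖lcoef f k‖ ≤ M := by
  have h := intervalIntegral.norm_integral_le_of_norm_le_const (a := 0) (b := 2 * Real.pi)
    (f := fun θ : ℝ => (Circle.exp θ : ℂ) ^ (-k) * f (Circle.exp θ)) (C := M) (fun θ _ => by
      rw [norm_mul, norm_zpow, Circle.norm_coe, one_zpow, one_mul]
      exact hM _ (exp_mem_sphere θ))
  rw [sub_zero, abs_of_pos Real.two_pi_pos] at h
  rw [lcoef, norm_mul, norm_inv, inv_mul_le_iff₀ (by simp [Real.pi_ne_zero])]
  refine h.trans (le_of_eq ?_)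
  rw [mul_comm]
  congr 1
  rw [← Complex.ofReal_ofNat, ← Complex.ofReal_mul, Complex.norm_of_nonneg Real.two_pi_pos.le]

theorem exists_norm_lcoef_le {f : ℂ → ℂ} (hf : ContinuousOn f (Metric.sphere 0 1)) :
    ∃ C, ∀ k, ‖lcoef f k‖ ≤ C := by
  obtain ⟨M, hM⟩ := (isCompact_sphere (0 : ℂ) 1).exists_bound_of_continuousOn hf
  exact ⟨M, norm_lcoef_le hM⟩

theorem integral_exp_zpow (k : ℤ) :
    ∫ θ in (0 : ℝ)..2 * Real.pi, (Circle.exp θ : ℂ) ^ k = if k = 0 then 2 * Real.pi else 0 := by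
  split_ifs with h
  · simp [h]
  · have hk : (k : ℂ) * Complex.I ≠ 0 := mul_ne_zero (by exact_mod_cast h) Complex.I_ne_zero
    have := integral_exp_mul_complex (a := 0) (b := 2 * Real.pi) hk
    have he : ∀ θ : ℝ, (Circle.exp θ : ℂ) ^ k = Complex.exp (k * Complex.I * θ) := by
      intro θ
      rw [Circle.coe_exp, ← Complex.exp_int_mul]
      congr 1
      ring
    simp only [he]
    rw [this]
    have : Complex.exp (k * Complex.I * (2 * Real.pi : ℝ)) = 1 := by
      rw [Complex.exp_eq_one_iff]
      exact ⟨k, by push_cast; ring⟩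
    rw [this]
    simp

theorem lcoef_one (k : ℤ) : lcoef (fun _ => 1) k = if k = 0 then 1 else 0 := by
  have : (2 * Real.pi : ℂ) ≠ 0 := by simp [Real.pi_ne_zero]
  simp only [lcoef, mul_one, integral_exp_zpow, neg_eq_zero]
  split_ifs
  · push_cast
    exact inv_mul_cancel₀ this
  · exact mul_zero _

/-- Fourier coefficients of the product of an absolutely convergent Fourier series with a
continuous function. -/
theorem hasSum_lcoef_mul {ι : Type*} [Countable ι] {f g : ℂ → ℂ} {a : ι → ℂ} {e : ι → ℤ}
    (ha : Summable fun i => ‖a i‖)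
    (hf : ∀ z ∈ Metric.sphere (0 : ℂ) 1, HasSum (fun i => a i * z ^ e i) (f z))
    (hg : ContinuousOn g (Metric.sphere 0 1)) (k : ℤ) :
    HasSum (fun i => a i * lcoef g (k - e i)) (lcoef (fun z => f z * g z) k) := by
  obtain ⟨M, hM⟩ := (isCompact_sphere (0 : ℂ) 1).exists_bound_of_continuousOn hg
  have h := intervalIntegral.hasSum_integral_of_dominated_convergence (a := 0)
    (b := 2 * Real.pi) (μ := MeasureTheory.volume)
    (F := fun (i : ι) (θ : ℝ) => a i * ((Circle.exp θ : ℂ) ^ (-(k - e i)) * g (Circle.exp θ)))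
    (f := fun θ : ℝ => (Circle.exp θ : ℂ) ^ (-k) * (f (Circle.exp θ) * g (Circle.exp θ)))
    (fun i _ => ‖a i‖ * M)
    (fun i => (continuous_const.mul (continuous_exp_zpow_mul hg _)).aestronglyMeasurable)
    (fun i => Eventually.of_forall fun θ _ => by
      rw [norm_mul, norm_mul, norm_zpow, Circle.norm_coe, one_zpow, one_mul]
      exact mul_le_mul_of_nonneg_left (hM _ (exp_mem_sphere θ)) (norm_nonneg _))
    (Eventually.of_forall fun θ _ => ha.mul_right M)
    (by simp)
    (Eventually.of_forall fun θ _ => by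
      refine (((hf _ (exp_mem_sphere θ)).mul_right (g (Circle.exp θ))).mul_left
        ((Circle.exp θ : ℂ) ^ (-k))).congr_fun fun i => ?_
      rw [neg_sub, sub_eq_add_neg, zpow_add₀ (Circle.coe_ne_zero _)]
      ring)
  simp only [intervalIntegral.integral_const_mul] at h
  refine (h.mul_left (2 * Real.pi : ℂ)⁻¹).congr_fun fun i => ?_
  simp only [lcoef]
  ring

/-! ### Laurent and Taylor expansions -/

theorem circleIntegral_eq_lcoef (f : ℂ → ℂ) {s : ℝ} (hs : s ≠ 0) (k : ℤ) :
    (∮ z in C(0, s), (z - 0)⁻¹ • (z ^ (-k) * f z)) =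
      2 * Real.pi * Complex.I * (s : ℂ) ^ (-k) * lcoef (fun z => f (s * z)) k := by
  have hpi : (2 * Real.pi : ℂ) ≠ 0 := by simp [Real.pi_ne_zero]
  have hs' : (s : ℂ) ≠ 0 := by exact_mod_cast hs
  rw [lcoef, circleIntegral]
  rw [show ∀ x : ℂ, 2 * Real.pi * Complex.I * (s : ℂ) ^ (-k) * ((2 * Real.pi : ℂ)⁻¹ * x) =
    Complex.I * (s : ℂ) ^ (-k) * x by intro x; field_simp,
    ← intervalIntegral.integral_const_mul]
  congr 1
  funext θ
  have hc : circleMap 0 s θ = s * (Circle.exp θ : ℂ) := by simp [circleMap]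
  have he : (Circle.exp θ : ℂ) ≠ 0 := Circle.coe_ne_zero _
  rw [deriv_circleMap, hc, mul_zpow, sub_zero, smul_eq_mul, smul_eq_mul]
  field_simp

/-- The Laurent coefficients of a function holomorphic in an annulus do not depend on the circle
that is used to compute them. -/
theorem lcoef_comp_mul {f : ℂ → ℂ} {r R s : ℝ} (hr : 0 ≤ r) (hr1 : r < 1) (hR : 1 < R)
    (hf : DifferentiableOn ℂ f (annulus r R)) (hs : r < s) (hs' : s < R) (k : ℤ) :
    lcoef (fun z => f (s * z)) k = (s : ℂ) ^ k * lcoef f k := by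
  have key : ∀ a b : ℝ, r < a → a ≤ b → b < R →
      (∮ z in C(0, b), (z - 0)⁻¹ • (z ^ (-k) * f z)) =
        ∮ z in C(0, a), (z - 0)⁻¹ • (z ^ (-k) * f z) := by
    intro a b ha hab hb
    have hd : DifferentiableOn ℂ (fun z => z ^ (-k) * f z) (annulus r R) := by
      refine DifferentiableOn.mul (fun z hz => ?_) hf
      exact (differentiableAt_zpow.2 (Or.inl (norm_pos_iff.1 (hr.trans_lt hz.1)))).differentiableWithinAt
    refine Complex.circleIntegral_sub_center_inv_smul_eq_of_differentiable_on_annulus_off_countable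
      (hr.trans_lt ha) hab Set.countable_empty (hd.continuousOn.mono ?_) ?_
    · rintro z ⟨h1, h2⟩
      rw [mem_closedBall_zero_iff] at h1
      rw [mem_ball_zero_iff, not_lt] at h2
      exact ⟨ha.trans_le h2, h1.trans_lt hb⟩
    · rintro z ⟨⟨h1, h2⟩, -⟩
      rw [mem_ball_zero_iff] at h1
      rw [mem_closedBall_zero_iff, not_le] at h2
      exact hd.differentiableAt ((isOpen_annulus r R).mem_nhds ⟨ha.trans h2, h1.trans hb⟩)
  have h1 : (∮ z in C(0, s), (z - 0)⁻¹ • (z ^ (-k) * f z)) =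
      ∮ z in C(0, (1 : ℝ)), (z - 0)⁻¹ • (z ^ (-k) * f z) := by
    rcases le_total s 1 with h | h
    · exact (key s 1 hs h hR).symm
    · exact key 1 s hr1 h hs'
  have hs0 : s ≠ 0 := (hr.trans_lt hs).ne'
  rw [circleIntegral_eq_lcoef f hs0, circleIntegral_eq_lcoef f one_ne_zero] at h1
  have hs0' : (s : ℂ) ≠ 0 := by exact_mod_cast hs0
  have h2 : (2 * Real.pi * Complex.I : ℂ) ≠ 0 := by simp [Real.pi_ne_zero]
  simp only [Complex.ofReal_one, one_zpow, one_mul, mul_one, mul_assoc] at h1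
  simp only [← mul_assoc] at h1
  rw [mul_assoc _ _ (lcoef _ _)] at h1
  have h3 := mul_left_cancel₀ h2 h1
  rw [← h3, ← mul_assoc, ← zpow_add₀ hs0']
  simp

theorem continuousOn_comp_mul {f : ℂ → ℂ} {r R s : ℝ} (hr : 0 ≤ r)
    (hf : DifferentiableOn ℂ f (annulus r R)) (hs : r < s) (hs' : s < R) :
    ContinuousOn (fun z => f (s * z)) (Metric.sphere 0 1) := by
  refine hf.continuousOn.comp (continuous_const.mul continuous_id).continuousOn fun z hz => ?_
  rw [mem_sphere_zero_iff_norm] at hz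
  have : ‖(s : ℂ) * z‖ = s := by
    rw [norm_mul, hz, mul_one, Complex.norm_of_nonneg (hr.trans hs.le)]
  exact ⟨hs.trans_eq this.symm, this.trans_lt hs'⟩

/-- Cauchy estimates for the Laurent coefficients. -/
theorem exists_norm_lcoef_mul_zpow_le {f : ℂ → ℂ} {r R s : ℝ} (hr : 0 ≤ r) (hr1 : r < 1)
    (hR : 1 < R) (hf : DifferentiableOn ℂ f (annulus r R)) (hs : r < s) (hs' : s < R) :
    ∃ C, ∀ k : ℤ, ‖lcoef f k‖ * s ^ k ≤ C := by
  obtain ⟨C, hC⟩ := exists_norm_lcoef_le (continuousOn_comp_mul hr hf hs hs')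
  refine ⟨C, fun k => ?_⟩
  have := hC k
  rwa [lcoef_comp_mul hr hr1 hR hf hs hs', norm_mul, norm_zpow,
    Complex.norm_of_nonneg (hr.trans hs.le), mul_comm] at this

/-- The Laurent series of a function holomorphic in an annulus converges absolutely. -/
theorem summable_norm_lcoef_mul_zpow {f : ℂ → ℂ} {r R s : ℝ} (hr : 0 ≤ r) (hr1 : r < 1)
    (hR : 1 < R) (hf : DifferentiableOn ℂ f (annulus r R)) (hs : r < s) (hs' : s < R) :
    Summable fun k : ℤ => ‖lcoef f k‖ * s ^ k := by
  -- Cauchy estimates on two neighbouring circles: the outer one gives ratio s / s₂ for positive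
  -- indices, the inner one ratio s₁ / s for negative indices.
  obtain ⟨s₁, h1, h1'⟩ := exists_between hs
  obtain ⟨s₂, h2, h2'⟩ := exists_between hs'
  obtain ⟨C₁, hC₁⟩ := exists_norm_lcoef_mul_zpow_le hr hr1 hR hf h1 (h1'.trans hs')
  obtain ⟨C₂, hC₂⟩ := exists_norm_lcoef_mul_zpow_le hr hr1 hR hf (hs.trans h2) h2'
  have p1 : 0 < s₁ := hr.trans_lt h1
  have p : 0 < s := p1.trans h1'
  have p2 : 0 < s₂ := p.trans h2
  refine Summable.of_nat_of_neg ?_ ?_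
  · have hg : Summable fun n : ℕ => C₂ * (s / s₂) ^ n :=
      (summable_geometric_of_lt_one (by positivity) ((div_lt_one p2).2 h2)).mul_left _
    refine hg.of_nonneg_of_le (fun n => by positivity) fun n => ?_
    have := hC₂ n
    rw [zpow_natCast] at this ⊢
    rw [div_pow, ← mul_div_assoc, le_div_iff₀ (by positivity)]
    nlinarith [mul_le_mul_of_nonneg_right this (pow_nonneg p.le n)]
  · have hg : Summable fun n : ℕ => C₁ * (s₁ / s) ^ n :=
      (summable_geometric_of_lt_one (by positivity) ((div_lt_one p).2 h1')).mul_left _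
    refine hg.of_nonneg_of_le (fun n => by positivity) fun n => ?_
    have := hC₁ (-n)
    rw [zpow_neg, zpow_natCast, ← div_eq_mul_inv, div_le_iff₀ (by positivity)] at this
    rw [zpow_neg, zpow_natCast, div_pow, ← mul_div_assoc, ← div_eq_mul_inv]
    gcongr

/-- An absolutely convergent Fourier series converges to its function. -/
theorem hasSum_lcoef_of_mem_sphere {f : ℂ → ℂ} (hf : ContinuousOn f (Metric.sphere 0 1))
    (hs : Summable fun k => ‖lcoef f k‖) {z : ℂ} (hz : z ∈ Metric.sphere (0 : ℂ) 1) :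
    HasSum (fun k => lcoef f k * z ^ k) (f z) := by
  have : Fact (0 < 2 * Real.pi) := ⟨Real.two_pi_pos⟩
  let g : C(AddCircle (2 * Real.pi), ℂ) :=
    ⟨fun x => f (AddCircle.toCircle x), hf.comp_continuous
      (continuous_subtype_val.comp AddCircle.continuous_toCircle) fun x => by
        rw [mem_sphere_zero_iff_norm]
        exact Circle.norm_coe _⟩
  have hto : ∀ θ : ℝ, (AddCircle.toCircle (θ : AddCircle (2 * Real.pi)) : ℂ) = Circle.exp θ := by
    intro θ
    rw [AddCircle.toCircle_apply_mk, div_self Real.two_pi_pos.ne', one_mul]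
  have hfou : ∀ (k : ℤ) (θ : ℝ), fourier k (θ : AddCircle (2 * Real.pi)) =
      (Circle.exp θ : ℂ) ^ k := by
    intro k θ
    rw [fourier_apply, AddCircle.toCircle_zsmul, Circle.coe_zpow, hto]
  have hco : ∀ k, fourierCoeff g k = lcoef f k := by
    intro k
    rw [fourierCoeff_eq_intervalIntegral g k 0, lcoef, zero_add, Complex.real_smul]
    congr 1
    · push_cast
      rw [one_div]
    · congr 1
      funext θ
      rw [hfou, smul_eq_mul]
      congr 1
      exact congrArg f (hto θ)
  obtain ⟨θ, hθ⟩ := Circle.exp_surjective ⟨z, by simpa [Submonoid.unitSphere] using hz⟩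
  have hθ' : (Circle.exp θ : ℂ) = z := congrArg Subtype.val hθ
  have h := has_pointwise_sum_fourier_series_of_summable (f := g)
    (hs.of_norm.congr fun k => (hco k).symm) θ
  simp only [hco, hfou, hθ', smul_eq_mul] at h
  convert h using 1
  change f z = f _
  rw [hto, hθ']

/-- The Laurent expansion of a function holomorphic in an annulus. -/
theorem hasSum_lcoef {f : ℂ → ℂ} {r R : ℝ} (hr : 0 ≤ r) (hr1 : r < 1)
    (hR : 1 < R) (hf : DifferentiableOn ℂ f (annulus r R)) {z : ℂ} (hz : z ∈ annulus r R) :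
    HasSum (fun k => lcoef f k * z ^ k) (f z) := by
  have hz0 : 0 < ‖z‖ := hr.trans_lt hz.1
  have hz0' : (‖z‖ : ℂ) ≠ 0 := by exact_mod_cast hz0.ne'
  -- Rescaling the circle through z to the unit circle reduces the claim to Fourier series.
  have hl := fun k => lcoef_comp_mul hr hr1 hR hf hz.1 hz.2 k
  have h := hasSum_lcoef_of_mem_sphere (continuousOn_comp_mul hr hf hz.1 hz.2)
    ((summable_norm_lcoef_mul_zpow hr hr1 hR hf hz.1 hz.2).congr fun k => by
      rw [hl, norm_mul, norm_zpow, Complex.norm_of_nonneg hz0.le, mul_comm])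
    (z := z / ‖z‖) (by simp [hz0.ne'])
  rw [mul_div_cancel₀ _ hz0'] at h
  refine h.congr_fun fun k => ?_
  rw [hl, div_zpow]
  field_simp

/-- A neighbourhood of the unit circle contains an annulus. -/
theorem exists_annulus_subset {U : Set ℂ} (hU : IsOpen U) (h : Metric.sphere (0 : ℂ) 1 ⊆ U) :
    ∃ δ : ℝ, 0 < δ ∧ δ < 1 ∧ annulus (1 - δ) (1 + δ) ⊆ U := by
  obtain ⟨δ, hδ, hsub⟩ := (isCompact_sphere (0 : ℂ) 1).exists_thickening_subset_open hU h
  -- The cap 1 / 2 keeps the annulus away from 0, so that z / ‖z‖ is the nearby point of the circle.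
  refine ⟨min δ (1 / 2), by positivity, (min_le_right _ _).trans_lt (by norm_num), ?_⟩
  rintro z ⟨h1, h2⟩
  have hd : |1 - ‖z‖| < δ := by
    rw [abs_lt]
    have := min_le_left δ (1 / 2)
    constructor <;> linarith
  have hz : 0 < ‖z‖ := by
    have := min_le_right δ (1 / 2)
    linarith
  have hz' : (‖z‖ : ℂ) ≠ 0 := by exact_mod_cast hz.ne'
  refine hsub (Metric.mem_thickening_iff.2 ⟨z / ‖z‖, by simp [hz.ne'], ?_⟩)
  have : z - z / ‖z‖ = z / ‖z‖ * ((‖z‖ - 1 : ℝ) : ℂ) := by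
    push_cast
    field_simp
  rw [dist_eq_norm, this, norm_mul, Complex.norm_real, norm_div, Complex.norm_real, norm_norm,
    div_self hz.ne', one_mul, Real.norm_eq_abs, abs_sub_comm]
  exact hd

theorem annulus_subset_ball (r R : ℝ) : annulus r R ⊆ Metric.ball 0 R := fun z hz => by
  rw [mem_ball_zero_iff]
  exact hz.2

theorem sphere_subset_ball {R : ℝ} (hR : 1 < R) : Metric.sphere (0 : ℂ) 1 ⊆ Metric.ball 0 R :=
  Metric.sphere_subset_closedBall.trans (Metric.closedBall_subset_ball hR)

/-- Negative Fourier coefficients of a function holomorphic in a disc vanish. -/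
theorem lcoef_eq_zero_of_neg {f : ℂ → ℂ} {R : ℝ} (hR : 1 < R)
    (hf : DifferentiableOn ℂ f (Metric.ball 0 R)) {k : ℤ} (hk : k < 0) : lcoef f k = 0 := by
  -- With k = -(m + 1) the integrand z^(-k-1) f is z^m f, holomorphic in the disc, and Cauchy's
  -- theorem applies.
  obtain ⟨m, rfl⟩ : ∃ m : ℕ, k = -(m + 1) := ⟨(-k - 1).toNat, by omega⟩
  have h := circleIntegral_eq_lcoef f one_ne_zero (-(m + 1))
  have hd : DifferentiableOn ℂ (fun z => z ^ m * f z) (Metric.ball 0 R) :=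
    (differentiable_id.pow m).differentiableOn.mul hf
  have h0 := Complex.circleIntegral_eq_zero_of_differentiable_on_off_countable zero_le_one
    Set.countable_empty (hd.continuousOn.mono (Metric.closedBall_subset_ball hR))
    (fun z hz => hd.differentiableAt (Metric.isOpen_ball.mem_nhds
      (Metric.ball_subset_ball hR.le hz.1)))
  have h1 : (∮ z in C(0, (1 : ℝ)), (z - 0)⁻¹ • (z ^ (-(-((m : ℤ) + 1))) * f z)) =
      ∮ z in C(0, (1 : ℝ)), z ^ m * f z := by
    refine circleIntegral.integral_congr zero_le_one fun z hz => ?_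
    have hz0 : z ≠ 0 := by
      rintro rfl
      simp at hz
    simp only [sub_zero, neg_neg, smul_eq_mul]
    rw [zpow_add₀ hz0, zpow_natCast, zpow_one]
    field_simp
  rw [h1, h0] at h
  simpa [Real.pi_ne_zero] using h.symm

theorem lcoef_zero_eq {f : ℂ → ℂ} {R : ℝ} (hR : 1 < R)
    (hf : DifferentiableOn ℂ f (Metric.ball 0 R)) : lcoef f 0 = f 0 := by
  have h := circleIntegral_eq_lcoef f one_ne_zero 0
  have h2 := (hf.diffContOnCl_ball (Metric.closedBall_subset_ball hR)).circleIntegral_sub_inv_smul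
    (Metric.mem_ball_self zero_lt_one)
  simp only [neg_zero, zpow_zero, one_mul, Complex.ofReal_one, mul_one] at h
  rw [h2, smul_eq_mul] at h
  exact (mul_left_cancel₀ (by simp [Real.pi_ne_zero]) h).symm

/-- The Taylor expansion in a disc, with coefficients computed on the unit circle. -/
theorem hasSum_lcoef_nat {f : ℂ → ℂ} {R : ℝ} (hR : 1 < R)
    (hf : DifferentiableOn ℂ f (Metric.ball 0 R)) {z : ℂ} (hz : z ∈ Metric.ball (0 : ℂ) R) :
    HasSum (fun n : ℕ => lcoef f n * z ^ n) (f z) := by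
  rcases eq_or_ne z 0 with rfl | h0
  · convert hasSum_single (f := fun n : ℕ => lcoef f n * (0 : ℂ) ^ n) 0 (fun n hn => by simp [hn])
      using 1
    simp [lcoef_zero_eq hR hf]
  have h := hasSum_lcoef le_rfl zero_lt_one hR (hf.mono (annulus_subset_ball 0 R))
    (z := z) ⟨norm_pos_iff.2 h0, by simpa using hz⟩
  refine ((Nat.cast_injective (R := ℤ)).hasSum_iff ?_).2 h |>.congr_fun fun n => by simp
  intro k hk
  rw [lcoef_eq_zero_of_neg hR hf, zero_mul]
  by_contra! hk'
  exact hk ⟨k.toNat, by simpa using hk'⟩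

theorem summable_norm_lcoef_nat {f : ℂ → ℂ} {R s : ℝ} (hR : 1 < R)
    (hf : DifferentiableOn ℂ f (Metric.ball 0 R)) (hs : 0 < s) (hs' : s < R) :
    Summable fun n : ℕ => ‖lcoef f n‖ * s ^ n := by
  have h := (summable_norm_lcoef_mul_zpow le_rfl zero_lt_one hR
    (hf.mono (annulus_subset_ball 0 R)) hs hs').comp_injective (Nat.cast_injective (R := ℤ))
  simpa [Function.comp_def] using h

/-- A power series is holomorphic in its disc of convergence. -/
theorem differentiableOn_tsum_pow {a : ℕ → ℂ} {R : ℝ}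
    (h : ∀ s, 0 < s → s < R → Summable fun n => ‖a n‖ * s ^ n) :
    DifferentiableOn ℂ (fun z => ∑' n, a n * z ^ n) (Metric.ball 0 R) := by
  intro z hz
  rw [mem_ball_zero_iff] at hz
  obtain ⟨s, h1, h2⟩ := exists_between hz
  have hd : DifferentiableOn ℂ (fun z => ∑' n, a n * z ^ n) (Metric.ball 0 s) := by
    refine Complex.differentiableOn_tsum_of_summable_norm (h s ((norm_nonneg z).trans_lt h1) h2)
      (fun n => ((differentiable_id.pow n).const_mul _).differentiableOn) Metric.isOpen_ball
      fun n w hw => ?_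
    rw [mem_ball_zero_iff] at hw
    rw [norm_mul, norm_pow]
    gcongr
  exact (hd.differentiableAt (Metric.isOpen_ball.mem_nhds (by simpa using h1))).differentiableWithinAt

/-! ### Reflection in the unit circle -/

/-- The reflection `z ↦ conj (f (1 / conj z))` of a function in the unit circle. -/
def refl (f : ℂ → ℂ) (z : ℂ) : ℂ := (starRingEnd ℂ) (f ((starRingEnd ℂ) z)⁻¹)

theorem refl_coe (f : ℂ → ℂ) (t : Circle) : refl f t = (starRingEnd ℂ) (f t) := by
  rw [refl, ← Circle.coe_inv_eq_conj, ← Circle.coe_inv, inv_inv]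

theorem refl_of_mem_sphere (f : ℂ → ℂ) {z : ℂ} (hz : z ∈ Metric.sphere (0 : ℂ) 1) :
    refl f z = (starRingEnd ℂ) (f z) :=
  refl_coe f ⟨z, by simpa [Submonoid.unitSphere] using hz⟩

theorem lcoef_refl (f : ℂ → ℂ) (k : ℤ) : lcoef (refl f) k = (starRingEnd ℂ) (lcoef f (-k)) := by
  simp only [lcoef, refl_coe, map_mul, map_inv₀, Complex.conj_ofReal, map_ofNat]
  rw [intervalIntegral.integral_of_le Real.two_pi_pos.le,
    intervalIntegral.integral_of_le Real.two_pi_pos.le, ← integral_conj]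
  simp only [map_mul, map_zpow₀, ← Circle.coe_inv_eq_conj, Circle.coe_inv, inv_zpow', neg_neg]

theorem differentiableAt_refl {f : ℂ → ℂ} {z : ℂ} (hz : z ≠ 0)
    (hf : DifferentiableAt ℂ f ((starRingEnd ℂ) z)⁻¹) : DifferentiableAt ℂ (refl f) z := by
  have h1 : DifferentiableAt ℂ ((starRingEnd ℂ) ∘ f ∘ (starRingEnd ℂ)) z⁻¹ := by
    rw [← Complex.conj_conj z⁻¹, map_inv₀]
    exact hf.conj_conj
  have h2 := h1.comp z (differentiableAt_inv hz)
  have e : refl f = ((starRingEnd ℂ) ∘ f ∘ (starRingEnd ℂ)) ∘ Inv.inv := by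
    ext w
    simp [refl]
  rw [e]
  exact h2

theorem differentiableOn_refl {f : ℂ → ℂ} {R : ℝ} (hR : 0 < R)
    (hf : DifferentiableOn ℂ f (Metric.ball 0 R)) : DifferentiableOn ℂ (refl f) {z | R⁻¹ < ‖z‖} := by
  intro z hz
  have hz0 : 0 < ‖z‖ := (inv_pos.2 hR).trans hz
  refine (differentiableAt_refl (norm_pos_iff.1 hz0) (hf.differentiableAt
    (Metric.isOpen_ball.mem_nhds ?_))).differentiableWithinAt
  rw [mem_ball_zero_iff, norm_inv, RCLike.norm_conj]
  exact inv_lt_of_inv_lt₀ hR hz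

/-- The expansion at infinity of the reflection of a function holomorphic in a disc. -/
theorem hasSum_refl {f : ℂ → ℂ} {R : ℝ} (hR : 1 < R)
    (hf : DifferentiableOn ℂ f (Metric.ball 0 R)) {z : ℂ} (hz : R⁻¹ < ‖z‖) :
    HasSum (fun n : ℕ => (starRingEnd ℂ) (lcoef f n) * z ^ (-(n : ℤ))) (refl f z) := by
  have hR0 := zero_lt_one.trans hR
  have h := Complex.hasSum_conj'.2 ((hasSum_lcoef_nat hR hf (z := ((starRingEnd ℂ) z)⁻¹) (by
    rw [mem_ball_zero_iff, norm_inv, RCLike.norm_conj]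
    exact inv_lt_of_inv_lt₀ hR0 hz)))
  exact h.congr_fun fun n => by simp

/-- Fourier coefficients of a product with the reflection of a function holomorphic in a disc. -/
theorem hasSum_lcoef_refl_mul {f g : ℂ → ℂ} {R : ℝ} (hR : 1 < R)
    (hf : DifferentiableOn ℂ f (Metric.ball 0 R))
    (hg : ContinuousOn g (Metric.sphere 0 1)) (k : ℤ) :
    HasSum (fun n : ℕ => (starRingEnd ℂ) (lcoef f n) * lcoef g (k + n))
      (lcoef (fun z => refl f z * g z) k) := by
  have h := hasSum_lcoef_mul (e := fun n : ℕ => -(n : ℤ)) (f := refl f)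
    (a := fun n : ℕ => (starRingEnd ℂ) (lcoef f n))
    (by simpa using summable_norm_lcoef_nat hR hf zero_lt_one hR)
    (fun z hz => hasSum_refl hR hf (by
      rw [mem_sphere_zero_iff_norm] at hz
      rw [hz]
      exact inv_lt_one_of_one_lt₀ hR)) hg k
  simpa using h

/-! ### The Szegő function and the factorization of the weight -/

/-- The symmetry of the Szegő function with respect to the unit circle. -/
theorem szego_eq_inv_refl (w : Circle → ℝ) {z : ℂ} (hz : z ≠ 0) (hz1 : ‖z‖ ≠ 1) :
    szego w z = (refl (szego w) z)⁻¹ := by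
  -- Since conj e = 1/e on the circle, conjugating the kernel at 1/conj z gives minus the kernel at
  -- z; log w is real.
  rw [refl, szego, szego, ← Complex.exp_conj, ← Complex.exp_neg]
  congr 1
  rw [map_mul, ← mul_neg]
  congr 1
  · simp [Complex.conj_ofNat]
  rw [intervalIntegral.integral_of_le Real.two_pi_pos.le,
    intervalIntegral.integral_of_le Real.two_pi_pos.le, ← integral_conj,
    ← MeasureTheory.integral_neg]
  congr 1
  funext θ
  have he : (Circle.exp θ : ℂ) ≠ 0 := Circle.coe_ne_zero _
  have h1 : (Circle.exp θ : ℂ) - z ≠ 0 := by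
    intro h
    rw [← sub_eq_zero.1 h] at hz1
    exact hz1 (Circle.norm_coe _)
  have h2 : z - (Circle.exp θ : ℂ) ≠ 0 := by
    rw [← neg_sub]
    exact neg_ne_zero.2 h1
  simp only [map_mul, map_div₀, map_add, map_sub, map_inv₀, Complex.conj_conj, Complex.conj_ofReal]
  rw [← Circle.coe_inv_eq_conj, Circle.coe_inv, ← mul_neg]
  congr 1
  have h3 : (Circle.exp θ : ℂ)⁻¹ - z⁻¹ = (z - Circle.exp θ) / (Circle.exp θ * z) := by
    field_simp
  have h4 : (Circle.exp θ : ℂ)⁻¹ + z⁻¹ = (z + Circle.exp θ) / (Circle.exp θ * z) := by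
    field_simp
  rw [h3, h4, div_div_div_cancel_right₀ (mul_ne_zero he hz), ← div_neg, neg_sub, add_comm]

/-- The Szegő function inside the disc in terms of the Fourier coefficients of `log w`. -/
theorem szego_eq_exp_tsum {w : Circle → ℝ} {L : ℂ → ℂ}
    (hL : ContinuousOn L (Metric.sphere 0 1)) (hLw : ∀ t : Circle, L t = Real.log (w t))
    {z : ℂ} (hz : ‖z‖ < 1) :
    szego w z = Complex.exp (∑' n : ℕ, lcoef L n * z ^ n - lcoef L 0 / 2) := by
  have hpi : (Real.pi : ℂ) ≠ 0 := by simp [Real.pi_ne_zero]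
  -- Coefficients of the kernel: (e + z)/(e - z) = 2 ∑ (z/e)^n - 1.
  let a : ℕ → ℂ := fun n => 2 * z ^ n - if n = 0 then 1 else 0
  have ha : Summable a :=
    ((summable_geometric_of_norm_lt_one hz).mul_left 2).sub (hasSum_ite_eq 0 1).summable
  have hf : ∀ e ∈ Metric.sphere (0 : ℂ) 1,
      HasSum (fun n : ℕ => a n * e ^ (-(n : ℤ))) ((e + z) / (e - z)) := by
    intro e he
    rw [mem_sphere_zero_iff_norm] at he
    have he0 : e ≠ 0 := norm_pos_iff.1 (by rw [he]; exact one_pos)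
    have hez : e - z ≠ 0 := by
      intro h
      rw [sub_eq_zero.1 h] at he
      exact hz.ne he
    have h1 := (hasSum_geometric_of_norm_lt_one (ξ := z / e) (by
      rwa [norm_div, he, div_one])).mul_left 2 |>.sub (hasSum_ite_eq (0 : ℕ) (1 : ℂ))
    have h2 : 2 * (1 - z / e)⁻¹ - 1 = (e + z) / (e - z) := by
      have : 1 - z / e = (e - z) / e := by field_simp
      rw [this]
      field_simp
      ring
    rw [h2] at h1
    refine h1.congr_fun fun n => ?_
    rw [zpow_neg, zpow_natCast, div_pow]
    rcases eq_or_ne n 0 with rfl | hn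
    · simp [a]
    · simp only [a, if_neg hn]
      ring
  have h := hasSum_lcoef_mul (summable_norm_iff.2 ha) hf hL 0
  have hLs : Summable fun n : ℕ => lcoef L n * z ^ n := by
    obtain ⟨C, hC⟩ := exists_norm_lcoef_le hL
    refine Summable.of_norm_bounded ((summable_geometric_of_lt_one (norm_nonneg z) hz).mul_left C)
      fun n => ?_
    rw [norm_mul, norm_pow]
    exact mul_le_mul_of_nonneg_right (hC _) (by positivity)
  have h' := (hLs.hasSum.mul_left 2).sub (hasSum_ite_eq (0 : ℕ) (lcoef L 0))
  have h2 := h.unique (h'.congr_fun fun n => by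
    rcases eq_or_ne n 0 with rfl | hn
    · simp [a]
      ring
    · simp only [a, if_neg hn, zero_sub, neg_neg]
      ring)
  rw [szego]
  congr 1
  have h3 : (∫ θ in (0 : ℝ)..2 * Real.pi, (Real.log (w (Circle.exp θ)) : ℂ) *
      (((Circle.exp θ : ℂ) + z) / ((Circle.exp θ : ℂ) - z))) =
      2 * Real.pi * lcoef (fun e => (e + z) / (e - z) * L e) 0 := by
    rw [lcoef, mul_inv_cancel_left₀ (mul_ne_zero two_ne_zero hpi)]
    congr 1
    funext θ
    rw [neg_zero, zpow_zero, one_mul, hLw, mul_comm]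
  rw [h3, h2]
  field_simp
  ring

/-- `D` is a holomorphic continuation to `|z| < R`, for some `R > 1`, of the Szegő function of `w`
in the unit disc, normalized and related to `w` in the usual way. -/
structure IsSzegoFactor (w : Circle → ℝ) (R : ℝ) (D : ℂ → ℂ) : Prop where
  one_lt : 1 < R
  differentiableOn : DifferentiableOn ℂ D (Metric.ball 0 R)
  ne_zero : ∀ z, D z ≠ 0
  conj_zero : (starRingEnd ℂ) (D 0) = D 0
  szego_int : ∀ z : ℂ, ‖z‖ < 1 → szego w z = D z
  szego_ext : ∀ z : ℂ, 1 < ‖z‖ → szego w z = (refl D z)⁻¹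
  weight_eq : ∀ t : Circle, (w t : ℂ) = D t * (starRingEnd ℂ) (D t)

/-- The Szegő factorization of a positive analytic weight. -/
theorem exists_szego_factor {w : Circle → ℝ} (hpos : ∀ t, 0 < w t) (hw : IsAnalyticWeight w) :
    ∃ R D, IsSzegoFactor w R D := by
  obtain ⟨W, hW, hWw⟩ := hw
  -- W is positive on the circle, hence in the slit plane nearby, so the principal logarithm is
  -- analytic there.
  set L : ℂ → ℂ := fun z => Complex.log (W z) with hLdef
  have hLw : ∀ t : Circle, L t = Real.log (w t) := fun t => by
    simp only [hLdef]
    rw [hWw, Complex.ofReal_log (hpos t).le]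
  have hLan : Metric.sphere (0 : ℂ) 1 ⊆ {z | AnalyticAt ℂ L z} := by
    intro z hz
    refine (hW z hz).clog ?_
    have := hWw ⟨z, by simpa [Submonoid.unitSphere] using hz⟩
    simp only at this
    rw [this]
    exact Complex.ofReal_mem_slitPlane.2 (hpos _)
  obtain ⟨δ, hδ, hδ1, hsub⟩ := exists_annulus_subset (isOpen_analyticAt ℂ L) hLan
  have hr : 0 ≤ 1 - δ := by linarith
  have hr1 : 1 - δ < 1 := by linarith
  have hR : 1 < 1 + δ := by linarith
  have hLd : DifferentiableOn ℂ L (annulus (1 - δ) (1 + δ)) := fun z hz =>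
    (hsub hz).differentiableAt.differentiableWithinAt
  have hLc : ContinuousOn L (Metric.sphere 0 1) :=
    hLd.continuousOn.mono (sphere_subset_annulus hr1 hR)
  -- The radius s may lie inside the hole of the annulus; for nonnegative powers max s 1 dominates
  -- it.
  have hsum : ∀ s, 0 < s → s < 1 + δ → Summable fun n : ℕ => ‖lcoef L n‖ * s ^ n := by
    intro s hs hs'
    have h := (summable_norm_lcoef_mul_zpow hr hr1 hR hLd
      (lt_max_of_lt_right hr1 : 1 - δ < max s 1) (max_lt hs' hR)).comp_injective
      (Nat.cast_injective (R := ℤ))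
    refine h.of_nonneg_of_le (fun n => by positivity) fun n => ?_
    simp only [Function.comp_apply, zpow_natCast]
    gcongr
    exact le_max_left _ _
  have hPd := differentiableOn_tsum_pow hsum
  have hconj : ∀ k, (starRingEnd ℂ) (lcoef L (-k)) = lcoef L k := fun k => by
    rw [← lcoef_refl]
    refine lcoef_congr (fun t => ?_) k
    rw [refl_coe, hLw, Complex.conj_ofReal]
  have hszego := fun (z : ℂ) (hz : ‖z‖ < 1) => szego_eq_exp_tsum hLc hLw hz
  refine ⟨1 + δ, fun z => Complex.exp (∑' n : ℕ, lcoef L n * z ^ n - lcoef L 0 / 2), hR,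
    (hPd.sub_const _).cexp, fun z => Complex.exp_ne_zero _, ?_, hszego, fun z hz => ?_, fun t => ?_⟩
  · rw [← Complex.exp_conj]
    congr 1
    rw [tsum_eq_single 0 (fun n hn => by simp [hn])]
    have := hconj 0
    rw [neg_zero] at this
    simp [this, Complex.conj_ofNat]
  · rw [szego_eq_inv_refl w (norm_pos_iff.1 (zero_lt_one.trans hz)) hz.ne', refl, hszego, refl]
    rw [norm_inv, RCLike.norm_conj]
    exact inv_lt_one_of_one_lt₀ hz
  · rw [← Complex.exp_conj, ← Complex.exp_add]
    have ht := coe_mem_sphere t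
    have h0 := hasSum_lcoef hr hr1 hR hLd (sphere_subset_annulus hr1 hR ht)
    have hs1 : Summable fun n : ℕ => lcoef L n * (t : ℂ) ^ n := by
      refine Summable.of_norm_bounded (hsum 1 one_pos hR) fun n => ?_
      rw [norm_mul, norm_pow, t.norm_coe]
    have h1 := hs1.hasSum
    have h2 : HasSum (fun n : ℕ => lcoef L (-(n : ℤ)) * (t : ℂ) ^ (-(n : ℤ)))
        ((starRingEnd ℂ) (∑' n : ℕ, lcoef L n * (t : ℂ) ^ n)) := by
      refine (Complex.hasSum_conj'.2 h1).congr_fun fun n => ?_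
      rw [map_mul, map_pow, ← hconj, neg_neg, ← Circle.coe_inv_eq_conj, Circle.coe_inv,
        zpow_neg, zpow_natCast, inv_pow]
    -- The two half series both count index 0. The correction by the zeroth coefficient is shared
    -- equally, which is why `lcoef L 0 / 2` is subtracted in the exponent of D.
    have h3 := h0.unique (HasSum.of_nat_of_neg (f := fun k : ℤ => lcoef L k * (t : ℂ) ^ k)
      (by simpa using h1) h2)
    have hc0 := hconj 0
    rw [neg_zero] at hc0
    rw [hLw] at h3
    simp only [zpow_zero, mul_one] at h3
    rw [map_sub, map_div₀, hc0, map_ofNat]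
    have h4 : ∑' n : ℕ, lcoef L n * (t : ℂ) ^ n - lcoef L 0 / 2 +
        ((starRingEnd ℂ) (∑' n : ℕ, lcoef L n * (t : ℂ) ^ n) - lcoef L 0 / 2) = Real.log (w t) := by
      rw [h3]
      ring
    rw [h4, ← Complex.ofReal_exp, Real.exp_log (hpos t)]

/-! ### Orthogonality as a Hankel system -/

theorem IsAnalyticWeight.continuous {w : Circle → ℝ} (hw : IsAnalyticWeight w) : Continuous w := by
  obtain ⟨W, hW, hWw⟩ := hw
  have h : Continuous fun t : Circle => (W t).re :=
    Complex.continuous_re.comp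
      (hW.continuousOn.comp_continuous continuous_subtype_val coe_mem_sphere)
  simpa [hWw] using h

/-- By the Gram-Schmidt recursion z^k is a combination of Φ_0, …, Φ_k, all orthogonal to Φ_n. -/
theorem pairing_monicOP_X_pow {w : Circle → ℝ} (hw : Continuous w) (hpos : ∀ t, 0 < w t) {k n : ℕ}
    (hkn : k < n) : pairing w (monicOP w n) (X ^ k) = 0 := by
  have h : X ^ k = monicOP w k - -∑ j : Fin k,
      C (pairing w (X ^ k) (monicOP w j) / pairing w (monicOP w j) (monicOP w j)) *
        monicOP w j := by
    rw [sub_neg_eq_add]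
    exact eq_add_of_sub_eq (monicOP_eq w k).symm
  have h2 : pairing w (X ^ k) (monicOP w n) = 0 := by
    rw [h, ← neg_one_mul, ← C_1, ← C_neg, pairing_sub_left hw, pairing_C_mul_left,
      pairing_sum_left hw, pairing_monicOP hw hpos hkn.ne', Finset.sum_eq_zero, mul_zero, sub_zero]
    intro j _
    rw [pairing_C_mul_left, pairing_monicOP hw hpos (j.2.trans hkn).ne', mul_zero]
  rw [← pairing_conj, h2, map_zero]

/-- Fourier coefficients of an absolutely convergent power series. -/
theorem lcoef_of_hasSum_pow {f : ℂ → ℂ} {a : ℕ → ℂ} (ha : Summable fun n => ‖a n‖)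
    (hf : ∀ z ∈ Metric.sphere (0 : ℂ) 1, HasSum (fun n => a n * z ^ n) (f z)) (n : ℕ) :
    lcoef f n = a n := by
  have h := hasSum_lcoef_mul (e := fun n : ℕ => (n : ℤ)) ha (by simpa using hf) (g := fun _ => 1)
    continuousOn_const n
  have h2 := hasSum_single (f := fun j : ℕ => a j * lcoef (fun _ => 1) ((n : ℤ) - j)) n
    (fun j hj => by
      rw [lcoef_one, if_neg (sub_ne_zero.2 (by exact_mod_cast hj.symm)), mul_zero])
  simpa [lcoef_one] using h.unique h2

theorem lcoef_polynomial (p : ℂ[X]) (n : ℕ) : lcoef (fun z => p.eval z) n = p.coeff n := by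
  refine lcoef_of_hasSum_pow (summable_of_hasFiniteSupport ?_) (fun z _ => ?_) n
  · refine p.support.finite_toSet.subset fun k hk => ?_
    simpa using hk
  · rw [eval_eq_sum, Polynomial.sum]
    exact hasSum_sum_of_ne_finset_zero fun k hk => by
      rw [notMem_support_iff.1 hk, zero_mul]

/-- The product formula for Fourier coefficients when those of one factor are supported on the
range of an injective map. -/
theorem hasSum_lcoef_mul_of_injective {f g : ℂ → ℂ} (hf : ContinuousOn f (Metric.sphere 0 1))
    (hfs : Summable fun k => ‖lcoef f k‖) (hg : ContinuousOn g (Metric.sphere 0 1))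
    {φ : ℕ → ℤ} (hφ : Function.Injective φ) (h0 : ∀ k ∉ Set.range φ, lcoef g k = 0) (k : ℤ) :
    HasSum (fun i => lcoef f (k - φ i) * lcoef g (φ i)) (lcoef (fun z => f z * g z) k) := by
  have h := hasSum_lcoef_mul (e := id) hfs
    (fun z hz => by simpa using hasSum_lcoef_of_mem_sphere hf hfs hz) hg k
  have h1 := (Equiv.subLeft k).hasSum_iff.2 h
  refine ((hφ.hasSum_iff fun j hj => ?_).2 h1).congr_fun fun i => ?_
  · simp [h0 j hj]
  · simp

theorem nonneg_mem_range_natCast {k : ℤ} (hk : k ∉ Set.range ((↑) : ℕ → ℤ)) : k < 0 := by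
  by_contra! h
  exact hk ⟨k.toNat, by simpa using h⟩

theorem neg_mem_range_neg_succ {k : ℤ} (hk : k ∉ Set.range fun m : ℕ => -((m : ℤ) + 1)) :
    0 ≤ k := by
  by_contra! h
  exact hk ⟨(-k - 1).toNat, by simp only; omega⟩

theorem continuousOn_refl_sphere {f : ℂ → ℂ} (hf : ContinuousOn f (Metric.sphere 0 1)) :
    ContinuousOn (refl f) (Metric.sphere 0 1) :=
  (Complex.continuous_conj.comp_continuousOn hf).congr fun _ hz => refl_of_mem_sphere f hz

/-- The reciprocal of the scattering function in terms of a Szegő factor. -/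
def recipScattering (D : ℂ → ℂ) (z : ℂ) : ℂ := refl D z / D z

namespace IsSzegoFactor

variable {w : Circle → ℝ} {R : ℝ} {D : ℂ → ℂ}

theorem inv_nonneg_lt (h : IsSzegoFactor w R D) : 0 ≤ R⁻¹ ∧ R⁻¹ < 1 :=
  ⟨inv_nonneg.2 (zero_le_one.trans h.one_lt.le), inv_lt_one_of_one_lt₀ h.one_lt⟩

theorem differentiableOn_inv (h : IsSzegoFactor w R D) :
    DifferentiableOn ℂ (fun z => (D z)⁻¹) (Metric.ball 0 R) :=
  h.differentiableOn.inv fun z _ => h.ne_zero z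

theorem refl_ne_zero (h : IsSzegoFactor w R D) (z : ℂ) : refl D z ≠ 0 := by
  rw [refl]
  exact (_root_.map_ne_zero _).2 (h.ne_zero _)

theorem differentiableOn_recip (h : IsSzegoFactor w R D) :
    DifferentiableOn ℂ (recipScattering D) (annulus R⁻¹ R) := by
  refine ((differentiableOn_refl (zero_lt_one.trans h.one_lt) h.differentiableOn).mono
    fun z hz => hz.1).div (h.differentiableOn.mono (annulus_subset_ball _ _)) fun z _ => h.ne_zero z

theorem continuousOn_sphere (h : IsSzegoFactor w R D) : ContinuousOn D (Metric.sphere 0 1) :=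
  h.differentiableOn.continuousOn.mono (sphere_subset_ball h.one_lt)

theorem continuousOn_recip_sphere (h : IsSzegoFactor w R D) :
    ContinuousOn (recipScattering D) (Metric.sphere 0 1) :=
  h.differentiableOn_recip.continuousOn.mono
    (sphere_subset_annulus h.inv_nonneg_lt.2 h.one_lt)

theorem summable_norm_lcoef_recip (h : IsSzegoFactor w R D) :
    Summable fun k => ‖lcoef (recipScattering D) k‖ := by
  simpa using summable_norm_lcoef_mul_zpow h.inv_nonneg_lt.1 h.inv_nonneg_lt.2 h.one_lt
    h.differentiableOn_recip h.inv_nonneg_lt.2 h.one_lt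

/-- The linear system that determines `Φ_n(0)` from the Fourier coefficients of the reciprocal of
the scattering function. -/
theorem exists_hankel_system (h : IsSzegoFactor w R D) (hw : Continuous w) (hpos : ∀ t, 0 < w t)
    (n : ℕ) : ∃ x y : ℕ → ℂ, (∃ M, ∀ j, ‖x j‖ ≤ M) ∧
      (∀ m : ℕ, HasSum (fun j : ℕ => (starRingEnd ℂ) (lcoef (recipScattering D)
        ((n + m + 1 + j : ℕ) : ℤ)) * x j) (-y m)) ∧
      (∀ j : ℕ, HasSum (fun m : ℕ => lcoef (recipScattering D) ((n + j + 1 + m + 1 : ℕ) : ℤ) * y m)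
        (-x (j + 1))) ∧
      HasSum (fun j : ℕ => (starRingEnd ℂ) (lcoef (recipScattering D) ((n + j : ℕ) : ℤ)) * x j)
        (D 0 * (monicOP w n).eval 0) ∧
      HasSum (fun m : ℕ => lcoef (recipScattering D) ((n + m + 1 : ℕ) : ℤ) * y m) (D 0 - x 0) := by
  set Φ := monicOP w n with hΦ
  set B := recipScattering D with hB
  have hR := h.one_lt
  have hDc := h.continuousOn_sphere
  have hAd := h.differentiableOn_inv
  set A : ℂ → ℂ := fun z => (D z)⁻¹ with hA
  have hAc : ContinuousOn A (Metric.sphere 0 1) :=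
    hAd.continuousOn.mono (sphere_subset_ball hR)
  have hΦc : ContinuousOn (fun z => Φ.eval z) (Metric.sphere 0 1) := Φ.continuous.continuousOn
  have hrD := continuousOn_refl_sphere hDc
  -- On the circle H = Φ_n w; pairing with z^k for k < n shows that its coefficients of index 0, …,
  -- n - 1 vanish.
  set H : ℂ → ℂ := fun z => Φ.eval z * (D z * refl D z) with hH
  have hHd : DifferentiableOn ℂ H (annulus R⁻¹ R) :=
    Φ.differentiable.differentiableOn.mul
      ((h.differentiableOn.mono (annulus_subset_ball _ _)).mul
        ((differentiableOn_refl (zero_lt_one.trans hR) h.differentiableOn).mono fun z hz => hz.1))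
  have hHc : ContinuousOn H (Metric.sphere 0 1) :=
    hHd.continuousOn.mono (sphere_subset_annulus h.inv_nonneg_lt.2 hR)
  have hH0 : ∀ k : ℕ, k < n → lcoef H k = 0 := by
    intro k hk
    have hp := pairing_monicOP_X_pow hw hpos hk
    rw [lcoef]
    convert mul_zero _
    rw [← hp, pairing]
    congr 1
    funext θ
    simp only [hH]
    rw [refl_coe, h.weight_eq, eval_pow, eval_X, map_pow, ← Circle.coe_inv_eq_conj, Circle.coe_inv,
      zpow_neg, zpow_natCast, inv_pow]
    ring
  have hsum : ∀ s, 0 < s → s < R → Summable fun j : ℕ => ‖lcoef H ((n + j : ℕ) : ℤ)‖ * s ^ j := by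
    intro s hs hs'
    have hm : R⁻¹ < max s 1 := lt_max_of_lt_right h.inv_nonneg_lt.2
    have h1 := (summable_norm_lcoef_mul_zpow h.inv_nonneg_lt.1 h.inv_nonneg_lt.2 hR hHd hm
      (max_lt hs' hR)).comp_injective
      (Nat.cast_injective.comp (add_right_injective n) : Function.Injective fun j : ℕ =>
        ((n + j : ℕ) : ℤ))
    refine h1.of_nonneg_of_le (fun j => by positivity) fun j => ?_
    simp only [Function.comp_apply, zpow_natCast]
    refine mul_le_mul_of_nonneg_left ?_ (norm_nonneg _)
    exact (pow_le_pow_left₀ hs.le (le_max_left _ _) j).trans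
      (pow_le_pow_right₀ (le_max_right _ _) (Nat.le_add_left _ _))
  -- z^n P collects the frequencies of H from n upwards; because of the gap, the remainder N has
  -- only negative ones.
  set P : ℂ → ℂ := fun z => ∑' j : ℕ, lcoef H ((n + j : ℕ) : ℤ) * z ^ j with hP
  have hPd : DifferentiableOn ℂ P (Metric.ball 0 R) := differentiableOn_tsum_pow hsum
  have hPc : ContinuousOn P (Metric.sphere 0 1) := hPd.continuousOn.mono (sphere_subset_ball hR)
  have hs1 : Summable fun j : ℕ => ‖lcoef H ((n + j : ℕ) : ℤ)‖ := by
    simpa using hsum 1 one_pos hR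
  have hPn : ∀ j : ℕ, lcoef P j = lcoef H ((n + j : ℕ) : ℤ) := by
    refine lcoef_of_hasSum_pow hs1 fun z hz => ?_
    rw [mem_sphere_zero_iff_norm] at hz
    exact (Summable.of_norm_bounded hs1 fun j => by rw [norm_mul, norm_pow, hz]; simp).hasSum
  set N : ℂ → ℂ := fun z => H z - z ^ (n : ℤ) * P z with hN
  have hzP : ContinuousOn (fun z => z ^ (n : ℤ) * P z) (Metric.sphere 0 1) :=
    (continuousOn_zpow_sphere n).mul hPc
  have hNc : ContinuousOn N (Metric.sphere 0 1) := hHc.sub hzP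
  have hN0 : ∀ k : ℤ, 0 ≤ k → lcoef N k = 0 := by
    intro k hk
    lift k to ℕ using hk
    rw [hN, lcoef_sub hHc hzP, lcoef_zpow_mul]
    rcases lt_or_ge k n with hkn | hkn
    · rw [hH0 k hkn, lcoef_eq_zero_of_neg hR hPd (by omega), sub_zero]
    · obtain ⟨j, rfl⟩ := Nat.exists_eq_add_of_le hkn
      rw [show ((n + j : ℕ) : ℤ) - n = j by push_cast; ring, hPn, sub_self]
  -- The unknowns are g = P/D, with no negative frequencies, and q = N/D*, with only negative ones.
  set g : ℂ → ℂ := fun z => A z * P z with hg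
  have hgc : ContinuousOn g (Metric.sphere 0 1) := hAc.mul hPc
  have hg0 : ∀ k : ℤ, k < 0 → lcoef g k = 0 := fun k hk =>
    lcoef_eq_zero_of_neg hR (hAd.mul hPd) hk
  set q : ℂ → ℂ := fun z => refl A z * N z with hq
  have hqc : ContinuousOn q (Metric.sphere 0 1) := (continuousOn_refl_sphere hAc).mul hNc
  have hq0 : ∀ k : ℤ, 0 ≤ k → lcoef q k = 0 := fun k hk =>
    ((hasSum_lcoef_refl_mul hR hAd hNc k).congr_fun fun i => by
      rw [hN0 _ (by positivity), mul_zero]).unique hasSum_zero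
  have hrefl : ∀ t : Circle, refl A t * refl D t = 1 := by
    intro t
    rw [refl_coe, refl_coe, ← map_mul, hA, inv_mul_cancel₀ (h.ne_zero _), map_one]
  have hAD : ∀ t : Circle, A t * D t = 1 := fun t => inv_mul_cancel₀ (h.ne_zero _)
  have hBt : ∀ t : Circle, B t = refl D t * A t := fun t => by
    rw [hB, recipScattering, div_eq_mul_inv]
  have hrBt : ∀ t : Circle, refl B t = D t * refl A t := fun t => by
    rw [refl_coe, hBt, map_mul, refl_coe, Complex.conj_conj, refl_coe]
  have hrB : ContinuousOn (refl B) (Metric.sphere 0 1) :=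
    continuousOn_refl_sphere h.continuousOn_recip_sphere
  have hrBs : Summable fun k => ‖lcoef (refl B) k‖ := by
    simp only [lcoef_refl, RCLike.norm_conj]
    exact (Equiv.neg ℤ).summable_iff.2 h.summable_norm_lcoef_recip
  -- On the circle q = D Φ - z^n B* g: this is H = z^n P + N divided by D*.
  have e1 : ∀ k, lcoef q k = lcoef (fun z => D z * Φ.eval z) k -
      lcoef (fun z => refl B z * g z) (k - n) := by
    intro k
    have c1 : ContinuousOn (fun z => D z * Φ.eval z) (Metric.sphere 0 1) := hDc.mul hΦc
    have c2 : ContinuousOn (fun z => z ^ (n : ℤ) * (refl B z * g z)) (Metric.sphere 0 1) :=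
      (continuousOn_zpow_sphere n).mul (hrB.mul hgc)
    rw [← lcoef_zpow_mul, ← lcoef_sub c1 c2]
    refine lcoef_congr (fun t => ?_) k
    simp only [hq, hN, hg, hH, hrBt]
    linear_combination D t * Φ.eval (t : ℂ) * hrefl t +
      (t : ℂ) ^ (n : ℤ) * P t * refl A t * hAD t
  -- On the circle z^n g = D* Φ - B q: the same identity divided by D.
  have e2 : ∀ k, lcoef g k = lcoef (fun z => refl D z * Φ.eval z) (k + n) -
      lcoef (fun z => B z * q z) (k + n) := by
    intro k
    have c1 : ContinuousOn (fun z => refl D z * Φ.eval z) (Metric.sphere 0 1) := hrD.mul hΦc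
    have c2 : ContinuousOn (fun z => B z * q z) (Metric.sphere 0 1) :=
      h.continuousOn_recip_sphere.mul hqc
    rw [← lcoef_sub c1 c2, ← add_sub_cancel_right k (n : ℤ), ← lcoef_zpow_mul,
      add_sub_cancel_right]
    refine lcoef_congr (fun t => ?_) _
    simp only [hq, hN, hg, hH, hBt]
    linear_combination (refl D t * Φ.eval (t : ℂ) * (A t * D t) -
      (t : ℂ) ^ (n : ℤ) * A t * P t) * hrefl t + refl D t * Φ.eval (t : ℂ) * hAD t
  have hDΦ : DifferentiableOn ℂ (fun z => D z * Φ.eval z) (Metric.ball 0 R) := h.differentiableOn.mul Φ.differentiable.differentiableOn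
  have s1 := fun k => hasSum_lcoef_mul_of_injective hrB hrBs hgc (Nat.cast_injective (R := ℤ))
    (fun k hk => hg0 k (nonneg_mem_range_natCast hk)) k
  have s2 := fun k => hasSum_lcoef_mul_of_injective (φ := fun m : ℕ => -((m : ℤ) + 1))
    h.continuousOn_recip_sphere h.summable_norm_lcoef_recip hqc (fun a b hab => by simpa using hab)
    (fun k hk => hq0 k (neg_mem_range_neg_succ hk)) k
  -- D* has only nonpositive powers, so D* Φ has no frequency above n, and its coefficient at n is
  -- conj D(0) = D(0) because Φ is monic.
  have s3 : ∀ k : ℤ, 0 < k → lcoef (fun z => refl D z * Φ.eval z) (k + n) = 0 := by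
    intro k hk
    lift k to ℕ using hk.le
    refine ((hasSum_lcoef_refl_mul hR h.differentiableOn hΦc _).congr_fun fun i => ?_).unique
      hasSum_zero
    rw [show (k : ℤ) + n + i = ((k + n + i : ℕ) : ℤ) by push_cast; rfl, lcoef_polynomial,
      coeff_eq_zero_of_natDegree_lt, mul_zero]
    rw [(monicOP_monic_natDegree w n).2]
    omega
  have s4 : lcoef (fun z => refl D z * Φ.eval z) (0 + n) = D 0 := by
    have h1 := hasSum_single (f := fun i : ℕ => (starRingEnd ℂ) (lcoef D i) *
      lcoef (fun z => Φ.eval z) (0 + (n : ℤ) + i)) 0 fun i hi => by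
        rw [show 0 + (n : ℤ) + i = ((n + i : ℕ) : ℤ) by push_cast; ring, lcoef_polynomial,
          coeff_eq_zero_of_natDegree_lt, mul_zero]
        rw [(monicOP_monic_natDegree w n).2]
        omega
    rw [(hasSum_lcoef_refl_mul hR h.differentiableOn hΦc _).unique h1]
    have h2 : Φ.coeff n = 1 := by
      have := (monicOP_monic_natDegree w n).1.coeff_natDegree
      rwa [(monicOP_monic_natDegree w n).2] at this
    simp only [Nat.cast_zero, add_zero, zero_add]
    rw [lcoef_polynomial, h2, mul_one, lcoef_zero_eq hR h.differentiableOn, h.conj_zero]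
  -- The two families of equations are `e1` at the negative indices and `e2` at the positive ones;
  -- index 0 of `e1` gives D(0) Φ(0), and index 0 of `e2` gives D(0) - x 0.
  refine ⟨fun j => lcoef g j, fun m => lcoef q (-((m : ℤ) + 1)), ?_, fun m => ?_, fun j => ?_, ?_, ?_⟩
  · obtain ⟨M, hM⟩ := exists_norm_lcoef_le hgc
    exact ⟨M, fun j => hM j⟩
  · beta_reduce
    rw [e1, lcoef_eq_zero_of_neg hR hDΦ (by omega), zero_sub, neg_neg]
    refine (s1 _).congr_fun fun j => ?_
    rw [lcoef_refl]
    congr 3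
    push_cast
    ring
  · beta_reduce
    rw [show ((j + 1 : ℕ) : ℤ) = (j : ℤ) + 1 by push_cast; rfl, e2, s3 _ (by positivity), zero_sub, neg_neg]
    refine (s2 _).congr_fun fun m => ?_
    congr 2
    push_cast
    ring
  · have := e1 0
    rw [hq0 0 le_rfl, lcoef_zero_eq hR hDΦ] at this
    rw [sub_eq_zero.1 this.symm]
    refine (s1 _).congr_fun fun j => ?_
    rw [lcoef_refl]
    congr 3
    push_cast
    ring
  · have := e2 0
    rw [s4] at this
    beta_reduce
    rw [Nat.cast_zero, this, sub_sub_cancel]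
    refine (s2 _).congr_fun fun m => ?_
    congr 2
    push_cast
    ring

end IsSzegoFactor

/-! ### The third-order estimate for the Hankel system -/

theorem norm_le_of_hasSum_of_geometric {f : ℕ → ℂ} {s : ℂ} {K r : ℝ} (hr0 : 0 ≤ r) (hr1 : r < 1)
    (hf : HasSum f s) (h : ∀ j, ‖f j‖ ≤ K * r ^ j) : ‖s‖ ≤ K * (1 - r)⁻¹ := by
  rw [← hf.tsum_eq]
  exact tsum_of_norm_bounded ((hasSum_geometric_of_lt_one hr0 hr1).mul_left K) h

/-- The solution of a Hankel system with geometrically small coefficients is determined by the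
leading coefficient up to an error of third order. -/
theorem norm_sub_le_of_hankel_system {β x y : ℕ → ℂ} {φ d : ℂ} {C r M : ℝ} {n : ℕ} (hr0 : 0 < r)
    (hr1 : r < 1) (hC : 0 ≤ C) (hβ : ∀ k, ‖β k‖ ≤ C * r ^ k)
    (hn : (C * (1 - r)⁻¹) ^ 2 * r ^ (2 * n) ≤ 1 / 2) (hd : d ≠ 0) (hM : ∀ j, ‖x j‖ ≤ M)
    (hy : ∀ m, HasSum (fun j => (starRingEnd ℂ) (β (n + m + 1 + j)) * x j) (-y m))
    (hx : ∀ j, HasSum (fun m => β (n + j + 1 + m + 1) * y m) (-x (j + 1)))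
    (hφ : HasSum (fun j => (starRingEnd ℂ) (β (n + j)) * x j) (d * φ))
    (hd' : HasSum (fun m => β (n + m + 1) * y m) (d - x 0)) :
    ‖φ - (starRingEnd ℂ) (β n)‖ ≤
      2 * C * (C * (1 - r)⁻¹) ^ 2 * ((1 - r)⁻¹ + 1) * r ^ (3 * n) := by
  set S := (1 - r)⁻¹ with hS
  have hS0 : 0 < S := inv_pos.2 (by linarith)
  have hpow : ∀ j, r ^ j ≤ 1 := fun j => pow_le_one₀ hr0.le hr1.le
  have hyb : ∀ M', (∀ j, ‖x j‖ ≤ M') → ∀ m, ‖y m‖ ≤ C * S * M' * r ^ n * r ^ m := by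
    intro M' hM' m
    have hM0 : 0 ≤ M' := (norm_nonneg _).trans (hM' 0)
    have h := norm_le_of_hasSum_of_geometric (K := C * M' * r ^ n * r ^ m) hr0.le hr1 (hy m)
      fun j => by
        rw [norm_mul, RCLike.norm_conj]
        calc ‖β (n + m + 1 + j)‖ * ‖x j‖ ≤ C * r ^ (n + m + 1 + j) * M' := by
              gcongr
              · exact hβ _
              · exact hM' j
          _ = C * M' * r ^ n * r ^ m * r ^ j * r := by ring
          _ ≤ C * M' * r ^ n * r ^ m * r ^ j := mul_le_of_le_one_right (by positivity) hr1.le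
    rw [norm_neg] at h
    refine h.trans (le_of_eq ?_)
    ring
  have hterm : ∀ M', (∀ j, ‖x j‖ ≤ M') → ∀ j m k : ℕ, n + j + m ≤ k →
      ‖β k * y m‖ ≤ C ^ 2 * S * M' * r ^ (2 * n) * r ^ j * r ^ m := by
    intro M' hM' j m k hk
    have hM0 : 0 ≤ M' := (norm_nonneg _).trans (hM' 0)
    rw [norm_mul]
    calc ‖β k‖ * ‖y m‖ ≤ C * r ^ (n + j + m) * (C * S * M' * r ^ n * r ^ m) := by
          gcongr
          · exact (hβ _).trans (mul_le_mul_of_nonneg_left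
              (pow_le_pow_of_le_one hr0.le hr1.le hk) hC)
          · exact hyb M' hM' m
      _ = C ^ 2 * S * M' * r ^ (2 * n) * r ^ j * r ^ m * r ^ m := by ring
      _ ≤ C ^ 2 * S * M' * r ^ (2 * n) * r ^ j * r ^ m :=
          mul_le_of_le_one_right (by positivity) (hpow m)
  -- Substituting the bound for y in the equation for x gains a second factor r^n; only x 0 escapes.
  have hxb : ∀ M', (∀ j, ‖x j‖ ≤ M') → ∀ j,
      ‖x (j + 1)‖ ≤ (C * S) ^ 2 * M' * r ^ (2 * n) * r ^ j := by
    intro M' hM' j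
    have h := norm_le_of_hasSum_of_geometric (K := C ^ 2 * S * M' * r ^ (2 * n) * r ^ j) hr0.le hr1
      (hx j) fun m => hterm M' hM' j m _ (by omega)
    rw [norm_neg] at h
    refine h.trans (le_of_eq ?_)
    ring
  -- `hM` makes the supremum T finite. By `hn` the entries after x 0 are at most T / 2, so T is
  -- bounded by ‖x 0‖.
  have hx0 : ∀ j, ‖x j‖ ≤ ‖x 0‖ := by
    have hbdd : BddAbove (Set.range fun j => ‖x j‖) := ⟨M, by rintro _ ⟨j, rfl⟩; exact hM j⟩
    set T := ⨆ j, ‖x j‖ with hT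
    have hle : ∀ j, ‖x j‖ ≤ T := fun j => le_ciSup hbdd j
    have hT0 : 0 ≤ T := (norm_nonneg _).trans (hle 0)
    have hsucc : ∀ j, ‖x (j + 1)‖ ≤ T / 2 := by
      intro j
      calc ‖x (j + 1)‖ ≤ (C * S) ^ 2 * T * r ^ (2 * n) * r ^ j := hxb T hle j
        _ ≤ (C * S) ^ 2 * T * r ^ (2 * n) := mul_le_of_le_one_right (by positivity) (hpow j)
        _ = (C * S) ^ 2 * r ^ (2 * n) * T := by ring
        _ ≤ 1 / 2 * T := by gcongr
        _ = T / 2 := by ring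
    have hmax : T ≤ max ‖x 0‖ (T / 2) := by
      refine ciSup_le fun j => ?_
      cases j with
      | zero => exact le_max_left _ _
      | succ j => exact (hsucc j).trans (le_max_right _ _)
    rcases le_max_iff.1 hmax with h | h
    · exact fun j => (hle j).trans h
    · intro j
      have : T ≤ 0 := by linarith
      exact ((hle j).trans this).trans (norm_nonneg _)
  have hdx : ‖d - x 0‖ ≤ (C * S) ^ 2 * r ^ (2 * n) * ‖x 0‖ := by
    have h := norm_le_of_hasSum_of_geometric (K := C ^ 2 * S * ‖x 0‖ * r ^ (2 * n) * r ^ 0) hr0.le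
      hr1 hd' fun m => hterm _ hx0 0 m _ (by omega)
    refine h.trans (le_of_eq ?_)
    ring
  -- The deviation d - x 0 is at most half of x 0; this is the source of the factor 2 in the final
  -- constant.
  have hx0d : ‖x 0‖ ≤ 2 * ‖d‖ := by
    have h1 : ‖d - x 0‖ ≤ 1 / 2 * ‖x 0‖ := hdx.trans (by gcongr)
    have h2 := norm_sub_norm_le (x 0) d
    rw [norm_sub_rev] at h2
    linarith
  -- Apart from the term j = 0, each term pairs a coefficient of size r^n with an entry of size
  -- r^(2n).
  have hu : ‖d * φ - (starRingEnd ℂ) (β n) * x 0‖ ≤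
      C * (C * S) ^ 2 * S * r ^ (3 * n) * ‖x 0‖ := by
    have h1 := (hasSum_nat_add_iff' 1).2 hφ
    simp only [Finset.range_one, Finset.sum_singleton, add_zero] at h1
    have h := norm_le_of_hasSum_of_geometric (K := C * (C * S) ^ 2 * r ^ (3 * n) * ‖x 0‖) hr0.le
      hr1 h1 fun j => by
        rw [norm_mul, RCLike.norm_conj]
        calc ‖β (n + (j + 1))‖ * ‖x (j + 1)‖
            ≤ C * r ^ n * ((C * S) ^ 2 * ‖x 0‖ * r ^ (2 * n) * r ^ j) := by
              gcongr
              · exact (hβ _).trans (mul_le_mul_of_nonneg_left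
                  (pow_le_pow_of_le_one hr0.le hr1.le (by omega)) hC)
              · exact hxb _ hx0 j
          _ = C * (C * S) ^ 2 * r ^ (3 * n) * ‖x 0‖ * r ^ j := by ring
    refine h.trans (le_of_eq ?_)
    ring
  have hfin : ‖d‖ * ‖φ - (starRingEnd ℂ) (β n)‖ ≤
      ‖d‖ * (2 * C * (C * S) ^ 2 * (S + 1) * r ^ (3 * n)) := by
    rw [← norm_mul]
    have e : d * (φ - (starRingEnd ℂ) (β n)) = (d * φ - (starRingEnd ℂ) (β n) * x 0) -
        (starRingEnd ℂ) (β n) * (d - x 0) := by ring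
    calc ‖d * (φ - (starRingEnd ℂ) (β n))‖
        ≤ C * (C * S) ^ 2 * S * r ^ (3 * n) * ‖x 0‖ +
          C * r ^ n * ((C * S) ^ 2 * r ^ (2 * n) * ‖x 0‖) := by
          rw [e]
          refine (norm_sub_le _ _).trans (add_le_add hu ?_)
          rw [norm_mul, RCLike.norm_conj]
          gcongr
          exact hβ n
      _ = C * (C * S) ^ 2 * (S + 1) * r ^ (3 * n) * ‖x 0‖ := by ring
      _ ≤ C * (C * S) ^ 2 * (S + 1) * r ^ (3 * n) * (2 * ‖d‖) := by gcongr
      _ = ‖d‖ * (2 * C * (C * S) ^ 2 * (S + 1) * r ^ (3 * n)) := by ring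
  exact le_of_mul_le_mul_left hfin (norm_pos_iff.2 hd)

theorem exists_bound_of_isBigO_pow {f : ℕ → ℂ} {r : ℝ} (hr : 0 < r)
    (h : f =O[atTop] fun n => r ^ n) : ∃ C, 0 ≤ C ∧ ∀ n, ‖f n‖ ≤ C * r ^ n := by
  obtain ⟨C, hC, h⟩ := Asymptotics.bound_of_isBigO_nat_atTop h
  refine ⟨C, hC.le, fun n => ?_⟩
  have := h (pow_pos hr n).ne'
  rwa [Real.norm_of_nonneg (by positivity)] at this

theorem isBigO_pow_of_bound {f : ℕ → ℂ} {r C : ℝ} (hr : 0 < r)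
    (h : ∀ᶠ n in atTop, ‖f n‖ ≤ C * r ^ n) : f =O[atTop] fun n => r ^ n := by
  refine Asymptotics.IsBigO.of_bound C (h.mono fun n hn => ?_)
  rwa [Real.norm_of_nonneg (by positivity)]

/-- The Verblunsky coefficients agree up to terms of third order with the negatives of the
Laurent coefficients of the reciprocal of the scattering function. -/
theorem IsSzegoFactor.isBigO_verblunsky_add {w : Circle → ℝ} {R : ℝ} {D : ℂ → ℂ}
    (h : IsSzegoFactor w R D) (hw : Continuous w) (hpos : ∀ t, 0 < w t) {r : ℝ} (hr0 : 0 < r)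
    (hr1 : r < 1)
    (hb : (fun n : ℕ => lcoef (recipScattering D) n) =O[atTop] fun n => r ^ n) :
    (fun n : ℕ => verblunsky w n + lcoef (recipScattering D) ((n + 1 : ℕ) : ℤ))
      =O[atTop] fun n => (r ^ 3) ^ n := by
  obtain ⟨C, hC, hβ⟩ := exists_bound_of_isBigO_pow hr0 hb
  have hlim : Tendsto (fun n : ℕ => (C * (1 - r)⁻¹) ^ 2 * r ^ (2 * (n + 1))) atTop (𝓝 0) := by
    have h1 := ((tendsto_pow_atTop_nhds_zero_of_lt_one (r := r ^ 2) (by positivity)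
      (pow_lt_one₀ hr0.le hr1 two_ne_zero)).comp (tendsto_add_atTop_nat 1)).const_mul
      ((C * (1 - r)⁻¹) ^ 2)
    rw [mul_zero] at h1
    refine h1.congr fun n => ?_
    simp only [Function.comp_apply]
    rw [← pow_mul]
  -- The smallness required of the Hankel system holds only for large n, which suffices for the
  -- asymptotic bound.
  have hev := hlim.eventually_le_const (show (0 : ℝ) < 1 / 2 by norm_num)
  refine isBigO_pow_of_bound (C := 2 * C * (C * (1 - r)⁻¹) ^ 2 * ((1 - r)⁻¹ + 1)) (by positivity)
    (hev.mono fun n hn => ?_)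
  obtain ⟨x, y, ⟨M, hM⟩, hy, hx, hφ, hd'⟩ := h.exists_hankel_system hw hpos (n + 1)
  have hmain := norm_sub_le_of_hankel_system (β := fun k => lcoef (recipScattering D) k)
    hr0 hr1 hC hβ hn (h.ne_zero 0) hM hy hx hφ hd'
  have e : verblunsky w n + lcoef (recipScattering D) ((n + 1 : ℕ) : ℤ) =
      -(starRingEnd ℂ) ((monicOP w (n + 1)).eval 0 -
        (starRingEnd ℂ) (lcoef (recipScattering D) ((n + 1 : ℕ) : ℤ))) := by
    rw [verblunsky, map_sub, Complex.conj_conj]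
    ring
  rw [e, norm_neg, RCLike.norm_conj]
  refine hmain.trans ?_
  have hS : 0 ≤ (1 - r)⁻¹ := inv_nonneg.2 (by linarith)
  refine mul_le_mul_of_nonneg_left ?_ (by positivity)
  rw [← pow_mul]
  exact pow_le_pow_of_le_one hr0.le hr1.le (by omega)

/-! ### Uniqueness of the continuations and the scattering function -/

/-- The exterior of a disc is the image of a half-plane under the exponential. -/
theorem isPreconnected_exterior {r : ℝ} (hr : 0 < r) : IsPreconnected {z : ℂ | r < ‖z‖} := by
  have h : {z : ℂ | r < ‖z‖} = Complex.exp '' {z | Real.log r < z.re} := by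
    ext z
    constructor
    · intro hz
      have hz0 : 0 < ‖z‖ := hr.trans hz
      refine ⟨Complex.log z, ?_, Complex.exp_log (norm_pos_iff.1 hz0)⟩
      rw [Set.mem_ofPred_eq, Complex.log_re]
      exact Real.log_lt_log hr hz
    · rintro ⟨u, hu, rfl⟩
      rw [Set.mem_ofPred_eq, Complex.norm_exp]
      exact (Real.log_lt_iff_lt_exp hr).1 hu
  rw [h]
  exact (convex_halfSpace_re_gt _).isPreconnected.image _ Complex.continuous_exp.continuousOn

theorem isOpen_exterior (r : ℝ) : IsOpen {z : ℂ | r < ‖z‖} :=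
  isOpen_lt continuous_const continuous_norm

theorem eqOn_exterior {f g : ℂ → ℂ} {r : ℝ} (hr : 0 < r)
    (hf : DifferentiableOn ℂ f {z | r < ‖z‖}) (hg : DifferentiableOn ℂ g {z | r < ‖z‖})
    (h : ∀ z : ℂ, 1 < ‖z‖ → f z = g z) : Set.EqOn f g {z | r < ‖z‖} := by
  -- The point max r 1 + 1 lies in both exteriors, also when r > 1.
  have hm : 1 < max r 1 + 1 := by
    have := le_max_right r 1
    linarith
  have hm' : r < max r 1 + 1 := by
    have := le_max_left r 1
    linarith
  have hn : ‖((max r 1 + 1 : ℝ) : ℂ)‖ = max r 1 + 1 :=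
    Complex.norm_of_nonneg (zero_le_one.trans hm.le)
  refine (hf.analyticOnNhd (isOpen_exterior r)).eqOn_of_preconnected_of_eventuallyEq
    (hg.analyticOnNhd (isOpen_exterior r)) (isPreconnected_exterior hr)
    (z₀ := ((max r 1 + 1 : ℝ) : ℂ)) (by rw [Set.mem_ofPred_eq, hn]; exact hm') ?_
  filter_upwards [(isOpen_exterior 1).mem_nhds
    (show ((max r 1 + 1 : ℝ) : ℂ) ∈ {z : ℂ | 1 < ‖z‖} by rw [Set.mem_ofPred_eq, hn]; exact hm)]
    with z hz using h z hz

theorem eqOn_ball {f g : ℂ → ℂ} {R : ℝ} (hR : 0 < R) (hf : DifferentiableOn ℂ f (Metric.ball 0 R))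
    (hg : DifferentiableOn ℂ g (Metric.ball 0 R)) (h : ∀ z : ℂ, ‖z‖ < 1 → f z = g z) :
    Set.EqOn f g (Metric.ball 0 R) := by
  refine (hf.analyticOnNhd Metric.isOpen_ball).eqOn_of_preconnected_of_eventuallyEq
    (hg.analyticOnNhd Metric.isOpen_ball) (convex_ball 0 R).isPreconnected
    (Metric.mem_ball_self hR) ?_
  filter_upwards [Metric.ball_mem_nhds (0 : ℂ) one_pos] with z hz
  exact h z (by simpa using hz)

namespace IsSzegoFactor

variable {w : Circle → ℝ} {R : ℝ} {D : ℂ → ℂ}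

theorem pos (h : IsSzegoFactor w R D) : 0 < R := zero_lt_one.trans h.one_lt

theorem differentiableOn_inv_refl (h : IsSzegoFactor w R D) :
    DifferentiableOn ℂ (fun z => (refl D z)⁻¹) {z | R⁻¹ < ‖z‖} :=
  (differentiableOn_refl h.pos h.differentiableOn).inv fun z _ => h.refl_ne_zero z

/-- Makes the choice in `szegoExt` immaterial. The identity theorem is applied on the common domain
of the two continuations. -/
theorem eqOn_of_isExteriorContinuation (h : IsSzegoFactor w R D) {F : ℂ → ℂ} {r : ℝ}
    (hF : IsExteriorContinuation w r F) :
    Set.EqOn F (fun z => (refl D z)⁻¹) {z | max r R⁻¹ < ‖z‖} := by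
  refine eqOn_exterior (lt_max_of_lt_right (inv_pos.2 h.pos))
    (hF.1.mono fun z (hz : max r R⁻¹ < ‖z‖) =>
      show r < ‖z‖ from (le_max_left _ _).trans_lt hz)
    (h.differentiableOn_inv_refl.mono fun z (hz : max r R⁻¹ < ‖z‖) =>
      show R⁻¹ < ‖z‖ from (le_max_right _ _).trans_lt hz) fun z hz => ?_
  rw [hF.2 z hz, h.szego_ext z hz]

theorem isExteriorContinuation (h : IsSzegoFactor w R D) :
    IsExteriorContinuation w R⁻¹ fun z => (refl D z)⁻¹ :=
  ⟨h.differentiableOn_inv_refl, fun z hz => (h.szego_ext z hz).symm⟩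

theorem szegoExt_eq (h : IsSzegoFactor w R D) {z : ℂ} (hz : R⁻¹ < ‖z‖) :
    szegoExt w z = (refl D z)⁻¹ := by
  have hex : ∃ F : ℂ → ℂ, ∃ r : ℝ, 0 < r ∧ r ≤ 1 ∧ r < ‖z‖ ∧ IsExteriorContinuation w r F :=
    ⟨_, R⁻¹, inv_pos.2 h.pos, h.inv_nonneg_lt.2.le, hz, h.isExteriorContinuation⟩
  rw [szegoExt, dif_pos hex]
  obtain ⟨r, -, -, hrz, hF⟩ := hex.choose_spec
  exact h.eqOn_of_isExteriorContinuation hF (max_lt hrz hz)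

theorem szegoInt_eq (h : IsSzegoFactor w R D) {z : ℂ} (hz : ‖z‖ < R) : szegoInt w z = D z := by
  have hex : ∃ F : ℂ → ℂ, ∃ R : ℝ, 1 ≤ R ∧ ‖z‖ < R ∧ IsInteriorContinuation w R F :=
    ⟨D, R, h.one_lt.le, hz, h.differentiableOn.mono fun _ hu => by simpa using hu,
      fun z hz => (h.szego_int z hz).symm⟩
  rw [szegoInt, dif_pos hex]
  obtain ⟨R', hR', hzR', hF⟩ := hex.choose_spec
  refine eqOn_ball (R := min R' R) (lt_min (zero_lt_one.trans_le hR') h.pos)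
    (hF.1.mono fun u hu => ?_)
    (h.differentiableOn.mono (Metric.ball_subset_ball (min_le_right _ _))) (fun u hu => ?_) ?_
  · rw [mem_ball_zero_iff] at hu
    exact hu.trans_le (min_le_left _ _)
  · rw [hF.2 u hu, h.szego_int u hu]
  · rw [mem_ball_zero_iff]
    exact lt_min hzR' hz

theorem scattering_eq (h : IsSzegoFactor w R D) {z : ℂ} (hz : z ∈ annulus R⁻¹ R) :
    scattering w z = D z * (refl D z)⁻¹ := by
  rw [scattering, h.szegoInt_eq hz.2, h.szegoExt_eq hz.1]

theorem differentiableOn_scattering (h : IsSzegoFactor w R D) :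
    DifferentiableOn ℂ (scattering w) (annulus R⁻¹ R) :=
  ((h.differentiableOn.mono (annulus_subset_ball _ _)).mul
    (h.differentiableOn_inv_refl.mono fun _ hz => hz.1)).congr fun _ hz => h.scattering_eq hz

/-! ### Critical radius and decay of coefficients -/

theorem criticalRadius_le_of_isExteriorContinuation {F : ℂ → ℂ} {r : ℝ} (hr0 : 0 < r)
    (hr1 : r < 1) (hF : IsExteriorContinuation w r F) : criticalRadius w ≤ r :=
  csInf_le ⟨0, fun _ hs => hs.1.le⟩
    (show r ∈ {r : ℝ | 0 < r ∧ r < 1 ∧ ∃ F : ℂ → ℂ, IsExteriorContinuation w r F} from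
      ⟨hr0, hr1, F, hF⟩)

theorem criticalRadius_lt_one (h : IsSzegoFactor w R D) : criticalRadius w < 1 :=
  (criticalRadius_le_of_isExteriorContinuation (inv_pos.2 h.pos) h.inv_nonneg_lt.2
    h.isExteriorContinuation).trans_lt h.inv_nonneg_lt.2

theorem criticalRadius_nonneg (w : Circle → ℝ) : 0 ≤ criticalRadius w :=
  Real.sInf_nonneg fun _ hr => hr.1.le

/-- Beyond the critical radius the Taylor coefficients of the reciprocal of the interior Szegő
function decay geometrically. -/
theorem isBigO_lcoef_inv (h : IsSzegoFactor w R D) {s : ℝ} (hs : criticalRadius w < s)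
    (hs1 : s < 1) : (fun n : ℕ => lcoef (fun z => (D z)⁻¹) n) =O[atTop] fun n => s ^ n := by
  obtain ⟨r, ⟨hr0, hr1, F, hF⟩, hrs⟩ := exists_lt_of_csInf_lt
    (s := {r : ℝ | 0 < r ∧ r < 1 ∧ ∃ F : ℂ → ℂ, IsExteriorContinuation w r F})
    ⟨R⁻¹, inv_pos.2 h.pos, h.inv_nonneg_lt.2, _, h.isExteriorContinuation⟩ hs
  have hs0 := hr0.trans hrs
  -- The outer radius 2 is arbitrary; any number above 1 would do.
  obtain ⟨C, hC⟩ := exists_norm_lcoef_mul_zpow_le hr0.le hr1 one_lt_two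
    (hF.1.mono fun z (hz : z ∈ annulus r 2) => hz.1) hrs (hs1.trans one_lt_two)
  refine isBigO_pow_of_bound hs0 (Eventually.of_forall fun n => ?_) (C := C)
  -- On the circle F is the reflection of 1/D, so its coefficients are those of 1/D, conjugated and
  -- with the index reversed.
  have e : lcoef F (-n) = (starRingEnd ℂ) (lcoef (fun z => (D z)⁻¹) n) := by
    rw [← neg_neg (n : ℤ), ← lcoef_refl, neg_neg]
    refine lcoef_congr (fun t => ?_) _
    rw [h.eqOn_of_isExteriorContinuation hF
      (by rw [Set.mem_ofPred_eq, t.norm_coe]; exact max_lt hr1 h.inv_nonneg_lt.2)]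
    simp [refl]
  have h1 := hC (-n)
  rw [e, RCLike.norm_conj, zpow_neg, zpow_natCast] at h1
  rwa [← div_eq_mul_inv, div_le_iff₀ (pow_pos hs0 n)] at h1

/-- Geometric decay of the Taylor coefficients of the reciprocal of the interior Szegő function
bounds the critical radius. -/
theorem criticalRadius_le (h : IsSzegoFactor w R D) {s : ℝ} (hs0 : 0 < s) (hs1 : s < 1)
    (hO : (fun n : ℕ => lcoef (fun z => (D z)⁻¹) n) =O[atTop] fun n => s ^ n) :
    criticalRadius w ≤ s := by
  obtain ⟨C, hC, hb⟩ := exists_bound_of_isBigO_pow hs0 hO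
  -- The continuation is this power series evaluated at 1/z, the expansion of D_e at infinity.
  have hd := differentiableOn_tsum_pow (R := s⁻¹)
    (a := fun n : ℕ => (starRingEnd ℂ) (lcoef (fun z => (D z)⁻¹) n)) fun t ht hts => by
      have hst : s * t < 1 := by
        rwa [lt_inv_comm₀ ht hs0, ← one_div, lt_div_iff₀ ht] at hts
      refine ((summable_geometric_of_lt_one (by positivity) hst).mul_left C).of_nonneg_of_le
        (fun n => by positivity) fun n => ?_
      rw [RCLike.norm_conj, mul_pow, ← mul_assoc]
      gcongr
      exact hb n
  refine criticalRadius_le_of_isExteriorContinuation hs0 hs1 ⟨hd.comp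
    (f := fun z : ℂ => z⁻¹) (fun z hz => ?_) fun z hz => ?_, fun z hz => ?_⟩
  · exact (differentiableAt_inv (norm_pos_iff.1 (hs0.trans hz))).differentiableWithinAt
  · rw [mem_ball_zero_iff, norm_inv]
    exact (inv_lt_inv₀ (hs0.trans hz) hs0).2 hz
  · rw [h.szego_ext z hz]
    have h1 := hasSum_refl h.one_lt h.differentiableOn_inv (h.inv_nonneg_lt.2.trans hz)
    simp only [Function.comp_apply]
    rw [show (refl D z)⁻¹ = refl (fun z => (D z)⁻¹) z by simp [refl], ← h1.tsum_eq]
    simp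

/-- A reflected factor has only nonpositive powers, so the coefficient of index n of the product
involves only coefficients of g of index at least n. -/
theorem isBigO_lcoef_refl_mul {f g : ℂ → ℂ} (hR : 1 < R)
    (hf : DifferentiableOn ℂ f (Metric.ball 0 R)) (hg : ContinuousOn g (Metric.sphere 0 1))
    {s : ℝ} (hs0 : 0 < s) (hs1 : s < 1) (hO : (fun n : ℕ => lcoef g n) =O[atTop] fun n => s ^ n) :
    (fun n : ℕ => lcoef (fun z => refl f z * g z) n) =O[atTop] fun n => s ^ n := by
  obtain ⟨C, hC, hb⟩ := exists_bound_of_isBigO_pow hs0 hO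
  have hsum : Summable fun i : ℕ => ‖lcoef f i‖ := by
    simpa using summable_norm_lcoef_nat hR hf one_pos hR
  refine isBigO_pow_of_bound hs0 (Eventually.of_forall fun n => ?_) (C := (∑' i : ℕ, ‖lcoef f i‖) * C)
  have h := hasSum_lcoef_refl_mul hR hf hg n
  rw [← h.tsum_eq]
  refine tsum_of_norm_bounded ((hsum.hasSum.mul_right C).mul_right (s ^ n)) fun i => ?_
  rw [norm_mul, RCLike.norm_conj, mul_assoc]
  refine mul_le_mul_of_nonneg_left ?_ (norm_nonneg _)
  have h1 := hb (n + i)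
  rw [Nat.cast_add] at h1
  exact h1.trans (mul_le_mul_of_nonneg_left (pow_le_pow_of_le_one hs0.le hs1.le (by omega)) hC)

theorem isBigO_recip_of_inv (h : IsSzegoFactor w R D) {s : ℝ} (hs0 : 0 < s) (hs1 : s < 1)
    (hO : (fun n : ℕ => lcoef (fun z => (D z)⁻¹) n) =O[atTop] fun n => s ^ n) :
    (fun n : ℕ => lcoef (recipScattering D) n) =O[atTop] fun n => s ^ n :=
  isBigO_lcoef_refl_mul h.one_lt h.differentiableOn
    (h.differentiableOn_inv.continuousOn.mono (sphere_subset_ball h.one_lt)) hs0 hs1 hO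

/-- The multiplication is invertible within the same class: 1/D = (1/D)* B on the circle. -/
theorem isBigO_inv_of_recip (h : IsSzegoFactor w R D) {s : ℝ} (hs0 : 0 < s) (hs1 : s < 1)
    (hO : (fun n : ℕ => lcoef (recipScattering D) n) =O[atTop] fun n => s ^ n) :
    (fun n : ℕ => lcoef (fun z => (D z)⁻¹) n) =O[atTop] fun n => s ^ n := by
  refine (isBigO_lcoef_refl_mul h.one_lt h.differentiableOn_inv h.continuousOn_recip_sphere
    hs0 hs1 hO).congr_left fun n => lcoef_congr (fun t => ?_) _
  have e : refl (fun z => (D z)⁻¹) t = (refl D t)⁻¹ := by simp [refl]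
  rw [e, recipScattering, div_eq_mul_inv, inv_mul_cancel_left₀ (h.refl_ne_zero _)]

theorem isBigO_recip (h : IsSzegoFactor w R D) {s : ℝ} (hs : criticalRadius w < s)
    (hs1 : s < 1) : (fun n : ℕ => lcoef (recipScattering D) n) =O[atTop] fun n => s ^ n :=
  h.isBigO_recip_of_inv ((criticalRadius_nonneg w).trans_lt hs) hs1 (h.isBigO_lcoef_inv hs hs1)

/-! ### Root asymptotics of the Verblunsky coefficients -/

theorem isBigO_verblunsky_add' (h : IsSzegoFactor w R D) (hw : Continuous w)
    (hpos : ∀ t, 0 < w t) {s : ℝ} (hs : criticalRadius w < s) (hs1 : s < 1) :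
    (fun n : ℕ => verblunsky w n + lcoef (recipScattering D) ((n + 1 : ℕ) : ℤ))
      =O[atTop] fun n => (s ^ 3) ^ n :=
  h.isBigO_verblunsky_add hw hpos ((criticalRadius_nonneg w).trans_lt hs) hs1 (h.isBigO_recip hs hs1)

theorem isBigO_pow_of_le {s t : ℝ} (hs : 0 ≤ s) (hst : s ≤ t) :
    (fun n : ℕ => s ^ n) =O[atTop] fun n => t ^ n :=
  Asymptotics.IsBigO.of_bound 1 (Eventually.of_forall fun n => by
    rw [one_mul, Real.norm_of_nonneg (by positivity), Real.norm_of_nonneg (pow_nonneg (hs.trans hst) n)]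
    gcongr)

theorem isBigO_verblunsky (h : IsSzegoFactor w R D) (hw : Continuous w)
    (hpos : ∀ t, 0 < w t) {s : ℝ} (hs : criticalRadius w < s) (hs1 : s < 1) :
    verblunsky w =O[atTop] fun n => s ^ n := by
  have hs0 := (criticalRadius_nonneg w).trans_lt hs
  have h1 := (h.isBigO_verblunsky_add' hw hpos hs hs1).trans
    (isBigO_pow_of_le (by positivity) (pow_le_of_le_one hs0.le hs1.le three_ne_zero))
  have h2 : (fun n : ℕ => lcoef (recipScattering D) ((n + 1 : ℕ) : ℤ)) =O[atTop]
      fun n => s ^ n :=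
    ((h.isBigO_recip hs hs1).comp_tendsto (tendsto_add_atTop_nat 1)).trans
      (Asymptotics.IsBigO.of_bound 1 (Eventually.of_forall fun n => by
        simp only [Function.comp_apply]
        rw [one_mul, Real.norm_of_nonneg (by positivity), Real.norm_of_nonneg (by positivity)]
        exact pow_le_pow_of_le_one hs0.le hs1.le (Nat.le_succ n)))
  exact (h1.sub h2).congr_left fun n => by ring

theorem eventually_rpow_norm_verblunsky_le (h : IsSzegoFactor w R D) (hw : Continuous w)
    (hpos : ∀ t, 0 < w t) {s : ℝ} (hs : criticalRadius w < s) (hs1 : s < 1) :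
    ∀ᶠ n : ℕ in atTop, ‖verblunsky w n‖ ^ (1 / (n : ℝ)) ≤ s := by
  -- The room between t and s absorbs the constant of the O-bound.
  obtain ⟨t, ht, hts⟩ := exists_between hs
  have ht0 := (criticalRadius_nonneg w).trans_lt ht
  have hs0 := ht0.trans hts
  have h1 := (h.isBigO_verblunsky hw hpos ht (hts.trans hs1)).trans_isLittleO
    (isLittleO_pow_pow_of_lt_left ht0.le hts)
  filter_upwards [h1.bound one_pos, eventually_ne_atTop 0] with n hn hn0
  rw [one_mul, Real.norm_of_nonneg (by positivity)] at hn
  calc ‖verblunsky w n‖ ^ (1 / (n : ℝ)) ≤ (s ^ n) ^ (1 / (n : ℝ)) := by gcongr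
    _ = s := by rw [one_div, Real.pow_rpow_inv_natCast hs0.le hn0]

theorem exists_gt_lt_one_of_eventually {ρ : ℝ} {P : ℝ → Prop}
    (hP : ∀ᶠ s in 𝓝 ρ, P s) (h1 : ρ < 1) : ∃ s, ρ < s ∧ s < 1 ∧ P s := by
  have h2 : ∀ᶠ s in 𝓝[>] ρ, s < 1 := nhdsWithin_le_nhds (eventually_lt_nhds h1)
  obtain ⟨s, ⟨hs1, hs2⟩, hs3⟩ := ((h2.and (nhdsWithin_le_nhds hP)).and self_mem_nhdsWithin).exists
  exact ⟨s, hs3, hs1, hs2⟩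

/-- A limsup below ρ would make α_n decay faster than ρ^n. Since α_n + b_{n+1} is of cubic order,
the b_n, and with them the coefficients of 1/D, would also decay faster, and D_e would continue
beyond ρ. -/
theorem limsup_verblunsky (h : IsSzegoFactor w R D) (hw : Continuous w) (hpos : ∀ t, 0 < w t) :
    limsup (fun n : ℕ => ‖verblunsky w n‖ ^ (1 / (n : ℝ))) atTop = criticalRadius w := by
  have hρ1 := h.criticalRadius_lt_one
  have hnn : ∀ n : ℕ, 0 ≤ ‖verblunsky w n‖ ^ (1 / (n : ℝ)) := fun n => by positivity
  have hco : IsCoboundedUnder (· ≤ ·) atTop fun n : ℕ => ‖verblunsky w n‖ ^ (1 / (n : ℝ)) :=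
    (isBoundedUnder_of_eventually_ge (Eventually.of_forall hnn)).isCoboundedUnder_le
  have hbd : IsBoundedUnder (· ≤ ·) atTop fun n : ℕ => ‖verblunsky w n‖ ^ (1 / (n : ℝ)) := by
    obtain ⟨s, hs, hs1⟩ := exists_between hρ1
    exact isBoundedUnder_of_eventually_le (h.eventually_rpow_norm_verblunsky_le hw hpos hs hs1)
  refine le_antisymm ?_ ?_
  · by_contra! hlt
    obtain ⟨s, hs, hs'⟩ := exists_between (lt_min hlt hρ1)
    exact absurd (limsup_le_of_le hco (h.eventually_rpow_norm_verblunsky_le hw hpos hs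
      (hs'.trans_le (min_le_right _ _)))) (not_le.2 (hs'.trans_le (min_le_left _ _)))
  · by_contra! hlt
    obtain ⟨r, hr, hrρ⟩ := exists_between hlt
    have hev := eventually_lt_of_limsup_lt hr hbd
    obtain ⟨n₀, hn₀⟩ := hev.exists
    have hr0 : 0 < r := (hnn n₀).trans_lt hn₀
    have hρ0 := hr0.trans hrρ
    -- Here ρ > 0, so ρ³ < ρ, and some s slightly above ρ still has s³ < ρ.
    obtain ⟨s, hs, hs1, hs3⟩ := exists_gt_lt_one_of_eventually (P := fun s => s ^ 3 < criticalRadius w)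
      ((continuous_pow 3).continuousAt.eventually_lt_const
        (pow_lt_self_of_lt_one₀ hρ0 hρ1 (by norm_num))) hρ1
    have hs0 := hρ0.trans hs
    set t := max r (s ^ 3) with ht
    have ht0 : 0 < t := lt_max_of_lt_left hr0
    have htρ : t < criticalRadius w := max_lt hrρ hs3
    have h1 := (h.isBigO_verblunsky_add' hw hpos hs hs1).trans
      (isBigO_pow_of_le (by positivity) (le_max_right r (s ^ 3)))
    have h2 : verblunsky w =O[atTop] fun n => t ^ n := by
      refine isBigO_pow_of_bound (C := 1) ht0 ?_
      filter_upwards [hev, eventually_ne_atTop 0] with n hn hn0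
      rw [one_mul]
      calc ‖verblunsky w n‖ = (‖verblunsky w n‖ ^ (1 / (n : ℝ))) ^ n := by
            rw [one_div, Real.rpow_inv_natCast_pow (norm_nonneg _) hn0]
        _ ≤ t ^ n := pow_le_pow_left₀ (hnn n) (hn.le.trans (le_max_left _ _)) n
    have h3 : (fun n : ℕ => lcoef (recipScattering D) n) =O[atTop] fun n => t ^ n := by
      rw [← map_add_atTop_eq_nat 1, Asymptotics.isBigO_map]
      have h4 := (h1.sub h2).congr_left
        (f₂ := (fun n : ℕ => lcoef (recipScattering D) n) ∘ fun n => n + 1) fun n => by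
          simp only [Function.comp_apply]
          ring
      refine h4.trans (Asymptotics.IsBigO.of_bound t⁻¹ (Eventually.of_forall fun n => ?_))
      simp only [Function.comp_apply]
      rw [← ht, pow_succ' t n, norm_mul, Real.norm_of_nonneg ht0.le, inv_mul_cancel_left₀ ht0.ne']
    exact absurd (h.criticalRadius_le ht0 (htρ.trans hρ1)
      (h.isBigO_inv_of_recip ht0 (htρ.trans hρ1) h3)) (not_le.2 htρ)

/-! ### The continuation of G(z) + 1/(z 𝒮(z)) -/

/-- The Laurent series of the reciprocal of the scattering function, multiplied by `1 / z`, is the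
sum of a power series in `z` and a power series in `1 / z`. -/
theorem hasSum_recip_split (h : IsSzegoFactor w R D) {z : ℂ} (hz : z ∈ annulus R⁻¹ R) :
    HasSum (fun n : ℕ => lcoef (recipScattering D) ((n + 1 : ℕ) : ℤ) * z ^ n)
      (z⁻¹ * recipScattering D z -
        z⁻¹ * ∑' m : ℕ, lcoef (recipScattering D) (-(m : ℤ)) * z⁻¹ ^ m) := by
  have hz0 : z ≠ 0 := norm_pos_iff.1 (h.inv_nonneg_lt.1.trans_lt hz.1)
  have h0 := hasSum_lcoef h.inv_nonneg_lt.1 h.inv_nonneg_lt.2 h.one_lt h.differentiableOn_recip hz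
  have h1 := h0.summable.comp_injective (i := fun n : ℕ => ((n + 1 : ℕ) : ℤ))
    (Nat.cast_injective.comp (add_left_injective 1))
  have h2 := h0.summable.comp_injective (i := fun m : ℕ => -(m : ℤ))
    (neg_injective.comp Nat.cast_injective)
  -- Applied to the index-reversed series, so that index 0 joins the nonpositive powers.
  have h3 := HasSum.of_nat_of_neg_add_one
    (f := fun k : ℤ => lcoef (recipScattering D) (-k) * z ^ (-k)) h2.hasSum
    (h1.hasSum.congr_fun fun n => by simp)
  have h4 := ((Equiv.neg ℤ).hasSum_iff.2 h0).unique h3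
  have h5 := (h1.hasSum.mul_left z⁻¹).congr_fun (g := fun n : ℕ =>
    lcoef (recipScattering D) ((n + 1 : ℕ) : ℤ) * z ^ n) fun n => by
      simp only [Function.comp_apply, zpow_natCast, pow_succ]
      field_simp
  have h6 : ∑' m : ℕ, lcoef (recipScattering D) (-(m : ℤ)) * z⁻¹ ^ m =
      ∑' m : ℕ, ((fun k : ℤ => lcoef (recipScattering D) k * z ^ k) ∘ fun m : ℕ => -(m : ℤ)) m :=
    tsum_congr fun m => by simp
  rw [h6, h4, ← mul_sub, add_sub_cancel_left]
  exact h5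

theorem summable_of_isBigO_pow {a : ℕ → ℂ} {s t : ℝ} (hs : 0 < s) (ht : 0 ≤ t) (hst : t * s < 1)
    (ha : a =O[atTop] fun n => s ^ n) : Summable fun n => ‖a n‖ * t ^ n := by
  obtain ⟨C, -, hC⟩ := exists_bound_of_isBigO_pow hs ha
  refine ((summable_geometric_of_lt_one (by positivity) hst).mul_left C).of_nonneg_of_le
    (fun n => by positivity) fun n => ?_
  rw [mul_pow, mul_comm (t ^ n), ← mul_assoc]
  gcongr
  exact hC n

theorem summable_mul_pow {a : ℕ → ℂ} {s : ℝ} {z : ℂ} (hs : 0 < s) (hz : ‖z‖ * s < 1)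
    (ha : a =O[atTop] fun n => s ^ n) : Summable fun n => a n * z ^ n :=
  .of_norm <| by simpa using summable_of_isBigO_pow hs (norm_nonneg z) hz ha

/-- The power series with coefficients `α_n + b_{n+1}` is holomorphic in `|z| < 1 / ρ³`. -/
theorem differentiableOn_tsum_add (h : IsSzegoFactor w R D) (hw : Continuous w)
    (hpos : ∀ t, 0 < w t) :
    DifferentiableOn ℂ (fun z => ∑' n : ℕ,
      (verblunsky w n + lcoef (recipScattering D) ((n + 1 : ℕ) : ℤ)) * z ^ n)
      {z | ‖z‖ * criticalRadius w ^ 3 < 1} := by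
  intro z hz
  -- The condition ‖z‖ s³ < 1 is open in s and holds at s = ρ; in this product form ρ = 0 needs no
  -- separate case.
  obtain ⟨s, hs, hs1, hsz⟩ := exists_gt_lt_one_of_eventually (P := fun s => ‖z‖ * s ^ 3 < 1)
    ((show Continuous fun s : ℝ => ‖z‖ * s ^ 3 by fun_prop).continuousAt.eventually_lt_const hz)
    h.criticalRadius_lt_one
  have hs0 : 0 < s ^ 3 := pow_pos ((criticalRadius_nonneg w).trans_lt hs) 3
  have hd := differentiableOn_tsum_pow (R := (s ^ 3)⁻¹) fun t ht hts =>
    summable_of_isBigO_pow hs0 ht.le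
      (by rwa [lt_inv_comm₀ ht hs0, ← one_div, lt_div_iff₀ ht, mul_comm] at hts)
      (h.isBigO_verblunsky_add' hw hpos hs hs1)
  refine (hd.differentiableAt (Metric.isOpen_ball.mem_nhds ?_)).differentiableWithinAt
  rw [mem_ball_zero_iff, ← one_div, lt_div_iff₀ hs0]
  exact hsz

/-- The principal part of the Laurent series of the reciprocal of the scattering function. -/
theorem differentiableOn_tsum_neg (h : IsSzegoFactor w R D) :
    DifferentiableOn ℂ (fun z : ℂ => ∑' m : ℕ, lcoef (recipScattering D) (-(m : ℤ)) * z⁻¹ ^ m)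
      {z | R⁻¹ < ‖z‖} := by
  have hd := differentiableOn_tsum_pow (R := R)
    (a := fun m : ℕ => lcoef (recipScattering D) (-(m : ℤ))) fun s hs hsR => by
      have hm : 0 < max s 1 := lt_max_of_lt_left hs
      have h1 := (summable_norm_lcoef_mul_zpow h.inv_nonneg_lt.1 h.inv_nonneg_lt.2 h.one_lt
        h.differentiableOn_recip (s := (max s 1)⁻¹)
        ((inv_lt_inv₀ h.pos hm).2 (max_lt hsR h.one_lt))
        ((inv_le_one_of_one_le₀ (le_max_right s 1)).trans_lt h.one_lt)).comp_injective
        (neg_injective.comp (Nat.cast_injective (R := ℤ)))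
      refine h1.of_nonneg_of_le (fun n => by positivity) fun n => ?_
      simp only [Function.comp_apply, zpow_neg, inv_zpow, inv_inv, zpow_natCast]
      gcongr
      exact le_max_left _ _
  refine hd.comp (f := fun z : ℂ => z⁻¹) (fun z hz => ?_) fun z hz => ?_
  · exact (differentiableAt_inv (norm_pos_iff.1
      (h.inv_nonneg_lt.1.trans_lt hz))).differentiableWithinAt
  · rw [mem_ball_zero_iff, norm_inv]
    exact inv_lt_of_inv_lt₀ h.pos hz

end IsSzegoFactor

end

end OPUC

/-! ### The main theorem -/

theorem mainTheorem5 (w : Circle → ℝ) (hpos : ∀ t : Circle, 0 < w t)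
    (hw : OPUC.IsAnalyticWeight w) :
    Filter.limsup (fun n : ℕ => ‖OPUC.verblunsky w n‖ ^ (1 / (n : ℝ))) Filter.atTop =
        OPUC.criticalRadius w ∧
      OPUC.criticalRadius w < 1 ∧
      ∃ ε : ℝ, 0 < ε ∧ ε < 1 ∧
        (∀ z : ℂ, ‖z‖ < 1 + ε → Summable (fun n : ℕ => OPUC.verblunsky w n * z ^ n)) ∧
        (DifferentiableOn ℂ (OPUC.scattering w) {z : ℂ | 1 - ε < ‖z‖ ∧ ‖z‖ < 1 + ε}) ∧
        (∀ z : ℂ, 1 - ε < ‖z‖ → ‖z‖ < 1 + ε → OPUC.scattering w z ≠ 0) ∧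
        ∃ F : ℂ → ℂ,
          DifferentiableOn ℂ F {z : ℂ | 1 - ε < ‖z‖ ∧ ‖z‖ * OPUC.criticalRadius w ^ 3 < 1} ∧
          ∀ z : ℂ, 1 - ε < ‖z‖ → ‖z‖ < 1 + ε →
            F z = (∑' n : ℕ, OPUC.verblunsky w n * z ^ n) + 1 / (z * OPUC.scattering w z) := by
  obtain ⟨R, D, h⟩ := OPUC.exists_szego_factor hpos hw
  have hwc := hw.continuous
  have hρ1 := h.criticalRadius_lt_one
  -- With ε = 1 - s, the inequality (2 - s) s ≤ 1 gives 1 + ε ≤ 1/s < R. The ε-annulus thus lies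
  -- where B is holomorphic, and G converges for ‖z‖ < 1 + ε.
  obtain ⟨s, hs, hs1⟩ := exists_between (max_lt hρ1 h.inv_nonneg_lt.2)
  have hρs : OPUC.criticalRadius w < s := (le_max_left _ _).trans_lt hs
  have hRs : R⁻¹ < s := (le_max_right _ _).trans_lt hs
  have hs0 : 0 < s := h.inv_nonneg_lt.1.trans_lt hRs
  have hα := h.isBigO_verblunsky hwc hpos hρs hs1
  have hmul : ∀ z : ℂ, ‖z‖ < 1 + (1 - s) → ‖z‖ * s < 1 := fun z hz => by
    nlinarith [sq_nonneg (1 - s), mul_lt_mul_of_pos_right hz hs0]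
  have hann : ∀ z : ℂ, 1 - (1 - s) < ‖z‖ → ‖z‖ < 1 + (1 - s) → z ∈ OPUC.annulus R⁻¹ R := by
    intro z h1 h2
    refine ⟨by linarith, ?_⟩
    have h3 := hmul z h2
    rw [← lt_div_iff₀ hs0, one_div] at h3
    exact h3.trans (inv_lt_of_inv_lt₀ h.pos hRs)
  refine ⟨h.limsup_verblunsky hwc hpos, hρ1, 1 - s, by linarith, by linarith,
    fun z hz => OPUC.IsSzegoFactor.summable_mul_pow hs0 (hmul z hz) hα,
    h.differentiableOn_scattering.mono fun z hz => hann z hz.1 hz.2, fun z h1 h2 => ?_,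
    fun z => (∑' n : ℕ, (OPUC.verblunsky w n +
      OPUC.lcoef (OPUC.recipScattering D) ((n + 1 : ℕ) : ℤ)) * z ^ n) +
      z⁻¹ * ∑' m : ℕ, OPUC.lcoef (OPUC.recipScattering D) (-(m : ℤ)) * z⁻¹ ^ m, ?_,
    fun z h1 h2 => ?_⟩
  · rw [h.scattering_eq (hann z h1 h2)]
    exact mul_ne_zero (h.ne_zero z) (inv_ne_zero (h.refl_ne_zero z))
  · refine ((h.differentiableOn_tsum_add hwc hpos).mono fun z hz => hz.2).add
      (DifferentiableOn.mul (fun z hz => ?_) (h.differentiableOn_tsum_neg.mono fun z hz => ?_))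
    · refine (differentiableAt_inv (norm_pos_iff.1 ?_)).differentiableWithinAt
      linarith [hz.1]
    · have := hz.1
      change R⁻¹ < ‖z‖
      linarith
  · have hz := hann z h1 h2
    have hsum := OPUC.IsSzegoFactor.summable_mul_pow hs0 (hmul z h2) hα
    have hb := h.hasSum_recip_split hz
    -- Adding the series of G to the positive part of B/z gives the first summand of F; the
    -- principal part of B/z is the second.
    have hadd := hsum.hasSum.add hb
    rw [h.scattering_eq hz]
    simp only [← add_mul] at hadd
    beta_reduce
    rw [hadd.tsum_eq, add_assoc, sub_add_cancel]
    congr 1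
    rw [OPUC.recipScattering, one_div, mul_inv, mul_inv, inv_inv, div_eq_mul_inv,
      mul_comm (D z)⁻¹]
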